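/- Functions are real-valued and $2\pi$-periodic; $C$ is the space of continuous functions with $\|f\|_C=\max_t|f(t)|$, and $L_s$, $1\le s\le\infty$, carries the norm $\|f\|_s=\big(\int_0^{2\pi}|f(t)|^s\,dt\big)^{1/s}$ for $s<\infty$ and $\|f\|_\infty=\operatorname{ess\,sup}|f|$. Let $a_k,b_k$ be the Fourier coefficients of $f\in L_1$, let $S_k(f;x)=\frac{a_0}{2}+\sum_{j=1}^k(a_j\cos jx+b_j\sin jx)$, and for natural numbers $p\le n$ let $$V_{n,p}(f;x)=\frac1p\sum_{k=n-p}^{n-1}S_k(f;x),\qquad \rho_{n,p}(f;x)=f(x)-V_{n,p}(f;x).$$ Let $E_m(\varphi)_{L_s}$ be the infimum of $\|\varphi-t\|_s$ over real trigonometric polynomials $t$ of order at most $m-1$. For $0<q<1$ put $\psi(k)=\frac{2}{q^k+q^{-k}}$, the coefficients of the Poisson kernel of the heat equation $\sum_{k\ge1}\psi(k)\cos(kt-\frac{\beta\pi}{2})$, $\beta\in\mathbb R$. For $f\in L_1$, if $\sum_{k\ge1}\frac1{\psi(k)}\big(a_k\cos(kx+\frac{\beta\pi}2)+b_k\sin(kx+\frac{\beta\pi}2)\big)$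 is the Fourier series of a function $f^\psi_\beta\in L_1$, this function is called the $(\psi,\beta)$-derivative of $f$; $C^\psi_\beta L_s$ is the set of $f\in C$ that have a $(\psi,\beta)$-derivative $f^\psi_\beta\in L_s$. Further, for $1\le u\le\infty$ (with $1/\infty=0$) put $$K_{q,p}(u)=2^{-1/u}\Big\|\frac{\sqrt{1-2q^p\cos pt+q^{2p}}}{1-2q\cos t+q^2}\Big\|_u,\qquad \sigma(u,p)=\begin{cases}1,&u=1,\ p=1,\\2,&1<u\le\infty,\ p=1,\\3,&p\ge2,\end{cases}\qquad \delta(s)=\begin{cases}0,&s=2,\\1,&s\ne2,\end{cases}$$ and, with $\frac1s+\frac1{s'}=1$, $$M=\frac{\|\cos t\|_{s'}}{\pi^{1+1/s'}}K_{q,p}(s'),\qquad R=\frac{q\,\delta(s)}{(n-p+1)(1-q)^{\sigma(s',p)}}+\frac{q^{2(n-p)+3}}{(1-q)^2}\min\Big\{p,\frac1{1-q}\Big\}.$$ **Theorem.** There is an absolute constant $A>0$ such that for all $q\in(0,1)$, $\beta\in\mathbb R$, $1\le s\le\infty$, all $n,p\in\mathbb N$ with $1\le p\le n$, and every $f\in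 C^\psi_\beta L_s$ the following hold. 1. $$\|\rho_{n,p}(f;\cdot)\|_C\le\frac{2q^{n-p+1}}{(1+q^{2(n-p+1)})\,p}\,(M+A\,R)\,E_{n-p+1}(f^\psi_\beta)_{L_s}.$$ 2. There is a function $F=F(f;n;p;\cdot)\in C^\psi_\beta L_s$ with $E_{n-p+1}(F^\psi_\beta)_{L_s}=E_{n-p+1}(f^\psi_\beta)_{L_s}$ and a real number $\theta$ with $|\theta|\le A$ such that $$\|\rho_{n,p}(F;\cdot)\|_C=\frac{2q^{n-p+1}}{(1+q^{2(n-p+1)})\,p}\,(M+\theta R)\,E_{n-p+1}(F^\psi_\beta)_{L_s}.$$ -/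

import Mathlib

open MeasureTheory

noncomputable section

namespace VallePoussin

/-- Lebesgue measure on one period `(0, 2π]`. -/
def periodMeasure : Measure ℝ := volume.restrict (Set.Ioc 0 (2 * Real.pi))

/-- The norm `‖f‖_u` of a `2π`-periodic function over one period, `1 ≤ u ≤ ∞`
(the essential supremum when `u = ∞`). -/
def normL (u : ENNReal) (f : ℝ → ℝ) : ℝ := (eLpNorm f u periodMeasure).toReal

/-- The uniform norm `‖f‖_C`. -/
def normC (f : ℝ → ℝ) : ℝ := ⨆ x : ℝ, |f x|

/-- `f` belongs to the space `C` of continuous `2π`-periodic functions. -/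
def MemC (f : ℝ → ℝ) : Prop := Function.Periodic f (2 * Real.pi) ∧ Continuous f

/-- `f` belongs to the space `L_s` of `2π`-periodic functions. -/
def MemL (s : ENNReal) (f : ℝ → ℝ) : Prop :=
  Function.Periodic f (2 * Real.pi) ∧ MemLp f s periodMeasure

/-- The Fourier cosine coefficient `a_k(f)`. -/
def fourierA (f : ℝ → ℝ) (k : ℕ) : ℝ :=
  (1 / Real.pi) * ∫ t in (0 : ℝ)..(2 * Real.pi), f t * Real.cos (k * t)

/-- The Fourier sine coefficient `b_k(f)`. -/
def fourierB (f : ℝ → ℝ) (k : ℕ) : ℝ :=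
  (1 / Real.pi) * ∫ t in (0 : ℝ)..(2 * Real.pi), f t * Real.sin (k * t)

/-- `φ` is a `(ψ, β)`-derivative of `f`: both functions are `2π`-periodic and summable, and
`∑_{k ≥ 1} ψ(k)⁻¹ (a_k(f) cos (k x + β π / 2) + b_k(f) sin (k x + β π / 2))`
is, term by term, the Fourier series of `φ` (so the constant term of `φ` vanishes). -/
def IsPsiBetaDeriv (ψ : ℕ → ℝ) (β : ℝ) (f φ : ℝ → ℝ) : Prop :=
  MemL 1 f ∧ MemL 1 φ ∧ fourierA φ 0 = 0 ∧
    ∀ k : ℕ, 1 ≤ k → ∀ x : ℝ,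
      fourierA φ k * Real.cos (k * x) + fourierB φ k * Real.sin (k * x) =
        (1 / ψ k) * (fourierA f k * Real.cos (k * x + β * Real.pi / 2) +
          fourierB f k * Real.sin (k * x + β * Real.pi / 2))

/-- `f` belongs to `C^ψ_β L_s` and `φ` is its `(ψ, β)`-derivative `f^ψ_β` (which is determined
by `f` up to equality almost everywhere). -/
def MemCPsiBeta (ψ : ℕ → ℝ) (β : ℝ) (s : ENNReal) (f φ : ℝ → ℝ) : Prop :=
  MemC f ∧ MemL s φ ∧ IsPsiBetaDeriv ψ β f φ

/-- The partial Fourier sum `S_k(f; x)` of order `k`. -/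
def fourierSum (f : ℝ → ℝ) (k : ℕ) (x : ℝ) : ℝ :=
  fourierA f 0 / 2 +
    ∑ j ∈ Finset.Icc 1 k, (fourierA f j * Real.cos (j * x) + fourierB f j * Real.sin (j * x))

/-- The de la Vallée Poussin sum `V_{n,p}(f; x)`, the mean of `S_{n-p}, …, S_{n-1}`
(used for `1 ≤ p ≤ n`). -/
def vpSum (n p : ℕ) (f : ℝ → ℝ) (x : ℝ) : ℝ :=
  (1 / (p : ℝ)) * ∑ k ∈ Finset.Ico (n - p) n, fourierSum f k x

/-- The deviation `ρ_{n,p}(f; x) = f(x) - V_{n,p}(f; x)`. -/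
def rho (n p : ℕ) (f : ℝ → ℝ) (x : ℝ) : ℝ := f x - vpSum n p f x

/-- The trigonometric polynomials of order at most `m - 1` (used for `m ≥ 1`). -/
def trigPoly (m : ℕ) : Set (ℝ → ℝ) :=
  {t | ∃ c d : ℕ → ℝ, ∀ x : ℝ,
    t x = ∑ k ∈ Finset.range m, (c k * Real.cos (k * x) + d k * Real.sin (k * x))}

/-- The best approximation `E_m(φ)_{L_s}` by trigonometric polynomials of order at most
`m - 1`. -/
def bestApprox (m : ℕ) (s : ENNReal) (φ : ℝ → ℝ) : ℝ :=
  sInf ((fun t : ℝ → ℝ => normL s (fun x => φ x - t x)) '' trigPoly m)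

/-- `ψ(k) = 2 / (q^k + q^{-k})`. -/
def heatPsi (q : ℝ) (k : ℕ) : ℝ := 2 / (q ^ k + (q ^ k)⁻¹)

/-- `K_{q,p}(u) = 2^{-1/u} ‖√(1 - 2 q^p cos p t + q^{2p}) / (1 - 2 q cos t + q^2)‖_u`,
where `1/∞ = 0`. -/
def kConst (q : ℝ) (p : ℕ) (u : ENNReal) : ℝ :=
  (2 : ℝ) ^ (-(u⁻¹).toReal) *
    normL u (fun t => Real.sqrt (1 - 2 * q ^ p * Real.cos (p * t) + q ^ (2 * p)) /
      (1 - 2 * q * Real.cos t + q ^ 2))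

/-- The exponent `σ(u, p)`. -/
def sigmaExp (u : ENNReal) (p : ℕ) : ℕ :=
  if p = 1 then (if u = 1 then 1 else 2) else 3

/-- `δ(s)`, equal to `0` for `s = 2` and to `1` otherwise. -/
def deltaConst (s : ENNReal) : ℝ := if s = 2 then 0 else 1

/-- The main constant `‖cos t‖_u / π^{1 + 1/u} · K_{q,p}(u)`. -/
def mainConst (q : ℝ) (p : ℕ) (u : ENNReal) : ℝ :=
  normL u Real.cos / Real.pi ^ (1 + (u⁻¹).toReal) * kConst q p u

/-- The order of the remainder. -/
def remainder (q : ℝ) (n p : ℕ) (s u : ENNReal) : ℝ :=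
  q * deltaConst s / (((n - p + 1 : ℕ) : ℝ) * (1 - q) ^ sigmaExp u p) +
    q ^ (2 * (n - p) + 3) / (1 - q) ^ 2 * min (p : ℝ) (1 / (1 - q))

/-- The leading factor `2 q^{n-p+1} / ((1 + q^{2(n-p+1)}) p)`. -/
def leadFactor (q : ℝ) (n p : ℕ) : ℝ :=
  2 * q ^ (n - p + 1) / ((1 + q ^ (2 * (n - p + 1))) * (p : ℝ))

end VallePoussin

end

namespace VallePoussin

/-! Put `m = n - p + 1`. A partial sum `S_i` misses the `k`-th harmonic exactly when `i < k`, so `p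
* rho` is, up to the factor `1/π`, the convolution of the derivative `φ` with the kernel `K(t) = ∑
w_k ψ(k) cos(kt - βπ/2)`, where `w_k = min p (k - (n-p))` with truncated subtraction
(`rho_eq_integral`). Since `K` has no harmonics below `m`, a trigonometric polynomial of order less
than `m` can be subtracted from `φ` at no cost, and Hölder gives `‖rho‖_C ≤ E_m(φ) ‖K‖_{s'} / (pπ)`
(`normC_rho_le`). Duality of the norms attains this up to any `η > 0`, with the same best
approximation (`exists_near_extremal`). Both claims thus reduce to an asymptotic formula for
`‖K‖_{s'}` (`abs_normL_vpKern_sub_le`).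

That formula has two ingredients. First, `ψ(m+j)` equals `ψ(m) q^j` up to a relative error of order
`q^{2m}`. Replacing one by the other turns `K` into `ψ(m) Re(e^{i(mt-b)} g(t))` with `g(t) = G(q
e^{it})` and `G(z) = ∑ min(p,j+1) z^j = (1-z^p)/(1-z)^2`; the modulus of `g` is the function inside
`kConst`. The uniform error is the second term of the remainder (`abs_vpKern_sub_modulated_le`).

Second, if the phase of the carrier is shifted by `θ` and the `u`-th power of the norm is averaged
over `θ`, the result is exactly that of `(2π)^{-1/u} ‖cos‖_u ‖g‖_u`, so some phase lies below this
value and some phase above it (`exists_phase`). A phase shift by `θ` is a translation by `θ/m`, up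
to the change of `g` under that translation (`modulated_close`). Hence the error is the `L_u`
modulus of continuity of `g` at step at most `2π/m`, which is the first term of the remainder
(`eLpNorm_vpGen_sub_le`). For `s = 2` this term is absent, because the oscillating part of the
square is the real part of a holomorphic function vanishing at the origin (`normL_two_modulated`).
-/

instance two_pi_pos_fact : Fact (0 < 2 * Real.pi) := ⟨Real.two_pi_pos⟩

/-! ### The period measure and its transfer to the circle -/

instance periodMeasure_isFiniteMeasure : IsFiniteMeasure periodMeasure := by
  unfold periodMeasure
  exact isFiniteMeasure_restrict.2 measure_Ioc_lt_top.ne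

lemma periodMeasure_univ : periodMeasure Set.univ = ENNReal.ofReal (2 * Real.pi) := by
  simp [periodMeasure]

lemma intervalIntegral_eq_integral_periodMeasure {E : Type*} [NormedAddCommGroup E]
    [NormedSpace ℝ E] (g : ℝ → E) :
    ∫ t in (0 : ℝ)..(2 * Real.pi), g t = ∫ t, g t ∂periodMeasure :=
  intervalIntegral.integral_of_le Real.two_pi_pos.le

section Translation

variable {E : Type*} [NormedAddCommGroup E] {g : ℝ → E}

lemma exists_circle_lift (hp : Function.Periodic g (2 * Real.pi)) (hg : Continuous g) :
    ∃ G : AddCircle (2 * Real.pi) → E, Continuous G ∧ ∀ x : ℝ, G x = g x := by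
  refine ⟨hp.lift, ?_, fun x => hp.lift_coe x⟩
  rw [(QuotientAddGroup.isQuotientMap_mk (N := AddSubgroup.zmultiples (2 * Real.pi))).continuous_iff]
  exact hg

lemma measurePreserving_circle :
    MeasurePreserving (fun x : ℝ => (x : AddCircle (2 * Real.pi))) periodMeasure volume := by
  have := AddCircle.measurePreserving_mk (2 * Real.pi) 0
  rwa [zero_add] at this

/-- Translations and reflections of the line move the interval `(0, 2π]`; the maps they induce on
the circle preserve Haar measure, so invariance of the norms is proved there. -/
lemma eLpNorm_comp_circle_map (hp : Function.Periodic g (2 * Real.pi)) (hg : Continuous g)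
    (u : ENNReal) (T : ℝ → ℝ) (S : AddCircle (2 * Real.pi) → AddCircle (2 * Real.pi))
    (hS : MeasurePreserving S volume volume) (hTS : ∀ x : ℝ, ((T x : ℝ) : AddCircle (2 * Real.pi)) = S x) :
    eLpNorm (fun t => g (T t)) u periodMeasure = eLpNorm g u periodMeasure := by
  obtain ⟨G, hG, hGg⟩ := exists_circle_lift hp hg
  have hae : AEStronglyMeasurable G (volume : Measure (AddCircle (2 * Real.pi))) :=
    hG.aestronglyMeasurable
  have h1 : (fun t => g (T t)) = G ∘ (S ∘ fun x : ℝ => (x : AddCircle (2 * Real.pi))) := by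
    funext t; simp [← hTS, hGg]
  have h2 : g = G ∘ fun x : ℝ => (x : AddCircle (2 * Real.pi)) := by
    funext t; simp [hGg]
  rw [h1, eLpNorm_comp_measurePreserving hae (hS.comp measurePreserving_circle)]
  conv_rhs => rw [h2]
  rw [eLpNorm_comp_measurePreserving hae measurePreserving_circle]

lemma eLpNorm_comp_add_right (hp : Function.Periodic g (2 * Real.pi)) (hg : Continuous g)
    (u : ENNReal) (c : ℝ) :
    eLpNorm (fun t => g (t + c)) u periodMeasure = eLpNorm g u periodMeasure := by
  exact eLpNorm_comp_circle_map hp hg u (fun t => t + c) (fun x => x + (c : AddCircle _))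
    (measurePreserving_add_right _ _) (fun x => by simp)

lemma eLpNorm_comp_sub_left (hp : Function.Periodic g (2 * Real.pi)) (hg : Continuous g)
    (u : ENNReal) (c : ℝ) :
    eLpNorm (fun t => g (c - t)) u periodMeasure = eLpNorm g u periodMeasure := by
  exact eLpNorm_comp_circle_map hp hg u (fun t => c - t) (fun x => (c : AddCircle _) - x)
    (Measure.measurePreserving_sub_left _ _) (fun x => by simp)

/-- On the circle, the set where a continuous function exceeds its essential supremum is open and
null, hence empty. -/
lemma enorm_le_eLpNorm_top (hp : Function.Periodic g (2 * Real.pi)) (hg : Continuous g) (x : ℝ) :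
    ‖g x‖ₑ ≤ eLpNorm g ⊤ periodMeasure := by
  obtain ⟨G, hG, hGg⟩ := exists_circle_lift hp hg
  have h2 : g = G ∘ fun x : ℝ => (x : AddCircle (2 * Real.pi)) := by
    funext t; simp [hGg]
  have h3 : eLpNorm g ⊤ periodMeasure = eLpNorm G ⊤ volume := by
    conv_lhs => rw [h2]
    exact eLpNorm_comp_measurePreserving hG.aestronglyMeasurable measurePreserving_circle
  rw [h3, ← hGg]
  by_contra! hlt
  have hopen : IsOpen {y | eLpNorm G ⊤ volume < ‖G y‖ₑ} :=
    isOpen_lt continuous_const hG.enorm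
  have hnull : volume {y | eLpNorm G ⊤ volume < ‖G y‖ₑ} = 0 := by
    have := ae_le_eLpNormEssSup (f := G) (μ := (volume : Measure (AddCircle (2 * Real.pi))))
    rw [← eLpNorm_exponent_top] at this
    simpa [ae_iff] using! this
  exact (Set.eq_empty_iff_forall_notMem.1 (hopen.measure_eq_zero_iff _ |>.1 hnull)) x hlt

lemma memLp_of_continuous_periodic (hp : Function.Periodic g (2 * Real.pi)) (hg : Continuous g)
    (u : ENNReal) : MemLp g u periodMeasure := by
  obtain ⟨G, hG, hGg⟩ := exists_circle_lift hp hg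
  have h2 : g = G ∘ fun x : ℝ => (x : AddCircle (2 * Real.pi)) := by
    funext t; simp [hGg]
  rw [h2]
  refine MemLp.comp_measurePreserving ?_ measurePreserving_circle
  obtain ⟨C, hC⟩ := isCompact_univ.exists_bound_of_continuousOn hG.continuousOn
  exact MemLp.of_bound hG.aestronglyMeasurable C (Filter.Eventually.of_forall fun y => hC y trivial)

lemma exists_forall_norm_le (hp : Function.Periodic g (2 * Real.pi)) (hg : Continuous g) :
    ∃ x₀, ∀ x, ‖g x‖ ≤ ‖g x₀‖ := by
  obtain ⟨G, hG, hGg⟩ := exists_circle_lift hp hg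
  obtain ⟨y, -, hy⟩ := isCompact_univ.exists_isMaxOn Set.univ_nonempty hG.norm.continuousOn
  obtain ⟨x₀, rfl⟩ := QuotientAddGroup.mk_surjective y
  refine ⟨x₀, fun x => ?_⟩
  have := hy (Set.mem_univ (x : AddCircle (2 * Real.pi)))
  simpa [hGg] using! this

end Translation

/-! ### Norms over a period and Hölder's inequality -/

lemma normL_nonneg (u : ENNReal) (f : ℝ → ℝ) : 0 ≤ normL u f := ENNReal.toReal_nonneg

/-- `‖f‖_u ≤ 2π sup |f|`. -/
lemma eLpNorm_le_two_pi_mul {E : Type*} [NormedAddCommGroup E] {f : ℝ → E} {u : ENNReal}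
    (hu : 1 ≤ u) {D : ℝ} (h : ∀ x, ‖f x‖ ≤ D) :
    eLpNorm f u periodMeasure ≤ ENNReal.ofReal (2 * Real.pi * D) := by
  refine (eLpNorm_le_of_ae_bound (C := D) (Filter.Eventually.of_forall h)).trans ?_
  rw [periodMeasure_univ, ENNReal.ofReal_mul Real.two_pi_pos.le]
  gcongr
  -- As `2π ≥ 1` and `1/u ≤ 1`, the factor `(2π)^{1/u}` is at most `2π`, uniformly in `u`.
  have h1 : (1 : ENNReal) ≤ ENNReal.ofReal (2 * Real.pi) := by
    rw [ENNReal.one_le_ofReal]; linarith [Real.pi_gt_three]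
  calc _ ≤ ENNReal.ofReal (2 * Real.pi) ^ (1 : ℝ) := by
        refine ENNReal.rpow_le_rpow_of_exponent_le h1 ?_
        rcases eq_or_ne u ⊤ with rfl | hu'
        · simp
        · exact inv_le_one_of_one_le₀ (by simpa using ENNReal.toReal_mono hu' hu)
    _ = _ := ENNReal.rpow_one _

/-- Hölder's inequality over one period. -/
lemma abs_integral_mul_le {s u : ENNReal} (h : ENNReal.HolderConjugate s u) {f g : ℝ → ℝ}
    (hf : MemLp f s periodMeasure) (hg : MemLp g u periodMeasure) :
    |∫ t, f t * g t ∂periodMeasure| ≤ normL s f * normL u g := by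
  have h1 := eLpNorm_smul_le_mul_eLpNorm (p := s) (q := u) (r := 1)
    hg.aestronglyMeasurable hf.aestronglyMeasurable
  have h2 : ‖∫ t, f t * g t ∂periodMeasure‖ₑ ≤ eLpNorm (f • g) 1 periodMeasure := by
    rw [eLpNorm_one_eq_lintegral_enorm]
    exact enorm_integral_le_lintegral_enorm _
  have h3 := ENNReal.toReal_mono (ENNReal.mul_lt_top hf.eLpNorm_lt_top hg.eLpNorm_lt_top).ne
    (h2.trans h1)
  rwa [ENNReal.toReal_mul, toReal_enorm, Real.norm_eq_abs] at h3

/-! ### Fourier coefficients, orthogonality and absolutely convergent series -/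

lemma fourierA_eq (f : ℝ → ℝ) (k : ℕ) :
    fourierA f k = (1 / Real.pi) * ∫ t, f t * Real.cos (k * t) ∂periodMeasure := by
  rw [fourierA, intervalIntegral_eq_integral_periodMeasure]

lemma fourierB_eq (f : ℝ → ℝ) (k : ℕ) :
    fourierB f k = (1 / Real.pi) * ∫ t, f t * Real.sin (k * t) ∂periodMeasure := by
  rw [fourierB, intervalIntegral_eq_integral_periodMeasure]

lemma integrable_mul_of_bound {φ g : ℝ → ℝ} (hφ : Integrable φ periodMeasure) (hg : Continuous g)
    {C : ℝ} (hC : ∀ t, |g t| ≤ C) : Integrable (fun t => φ t * g t) periodMeasure :=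
  hφ.mul_bdd (c := C) hg.aestronglyMeasurable (Filter.Eventually.of_forall hC)

lemma integrable_mul_cos {φ : ℝ → ℝ} (hφ : Integrable φ periodMeasure) (k : ℝ) :
    Integrable (fun t => φ t * Real.cos (k * t)) periodMeasure :=
  integrable_mul_of_bound hφ (by fun_prop) (fun t => Real.abs_cos_le_one _)

lemma integrable_mul_sin {φ : ℝ → ℝ} (hφ : Integrable φ periodMeasure) (k : ℝ) :
    Integrable (fun t => φ t * Real.sin (k * t)) periodMeasure :=
  integrable_mul_of_bound hφ (by fun_prop) (fun t => Real.abs_sin_le_one _)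

lemma integral_cos_int (n : ℤ) :
    ∫ t, Real.cos (n * t) ∂periodMeasure = if n = 0 then 2 * Real.pi else 0 := by
  rw [← intervalIntegral_eq_integral_periodMeasure]
  split_ifs with h
  · simp [h]
  · rw [intervalIntegral.integral_comp_mul_left (fun t => Real.cos t) (Int.cast_ne_zero.2 h),
      integral_cos]
    have := Real.sin_int_mul_pi (n * 2)
    push_cast at this
    rw [← mul_assoc, this]; simp

lemma integral_sin_int (n : ℤ) : ∫ t, Real.sin (n * t) ∂periodMeasure = 0 := by
  rw [← intervalIntegral_eq_integral_periodMeasure]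
  rcases eq_or_ne n 0 with h | h
  · simp [h]
  · rw [intervalIntegral.integral_comp_mul_left (fun t => Real.sin t) (Int.cast_ne_zero.2 h),
      integral_sin]
    have := Real.cos_int_mul_two_pi n
    rw [this]; simp

lemma integrable_of_continuous_bdd {g : ℝ → ℝ} (hg : Continuous g) {C : ℝ}
    (hC : ∀ t, |g t| ≤ C) : Integrable g periodMeasure :=
  Integrable.of_bound hg.aestronglyMeasurable C (Filter.Eventually.of_forall hC)

lemma integral_cos_mul_cos (k j : ℕ) :
    ∫ t, Real.cos (k * t) * Real.cos (j * t) ∂periodMeasure =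
      if k = j then (if j = 0 then 2 * Real.pi else Real.pi) else 0 := by
  have h : ∀ t : ℝ, Real.cos (k * t) * Real.cos (j * t) =
      (1 / 2) * (Real.cos (((k - j : ℤ) : ℝ) * t) + Real.cos (((k + j : ℤ) : ℝ) * t)) := by
    intro t
    push_cast
    rw [sub_mul, add_mul, Real.cos_sub, Real.cos_add]; ring
  simp_rw [h]
  rw [integral_const_mul, integral_add
    (integrable_of_continuous_bdd (by fun_prop) (fun t => Real.abs_cos_le_one _))
    (integrable_of_continuous_bdd (by fun_prop) (fun t => Real.abs_cos_le_one _)),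
    integral_cos_int, integral_cos_int]
  have e1 : ((k : ℤ) - j = 0) ↔ k = j := by omega
  have e2 : ((k : ℤ) + j = 0) ↔ k = 0 ∧ j = 0 := by omega
  simp only [e1, e2]
  split_ifs <;> first | omega | ring

lemma integral_sin_mul_sin (k j : ℕ) :
    ∫ t, Real.sin (k * t) * Real.sin (j * t) ∂periodMeasure =
      if k = j then (if j = 0 then 0 else Real.pi) else 0 := by
  have h : ∀ t : ℝ, Real.sin (k * t) * Real.sin (j * t) =
      (1 / 2) * (Real.cos (((k - j : ℤ) : ℝ) * t) - Real.cos (((k + j : ℤ) : ℝ) * t)) := by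
    intro t
    push_cast
    rw [sub_mul, add_mul, Real.cos_sub, Real.cos_add]; ring
  simp_rw [h]
  rw [integral_const_mul, integral_sub
    (integrable_of_continuous_bdd (by fun_prop) (fun t => Real.abs_cos_le_one _))
    (integrable_of_continuous_bdd (by fun_prop) (fun t => Real.abs_cos_le_one _)),
    integral_cos_int, integral_cos_int]
  have e1 : ((k : ℤ) - j = 0) ↔ k = j := by omega
  have e2 : ((k : ℤ) + j = 0) ↔ k = 0 ∧ j = 0 := by omega
  simp only [e1, e2]
  split_ifs <;> first | omega | ring

lemma integral_sin_mul_cos (k j : ℕ) :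
    ∫ t, Real.sin (k * t) * Real.cos (j * t) ∂periodMeasure = 0 := by
  have h : ∀ t : ℝ, Real.sin (k * t) * Real.cos (j * t) =
      (1 / 2) * (Real.sin (((k - j : ℤ) : ℝ) * t) + Real.sin (((k + j : ℤ) : ℝ) * t)) := by
    intro t
    push_cast
    rw [sub_mul, add_mul, Real.sin_sub, Real.sin_add]; ring
  simp_rw [h]
  rw [integral_const_mul, integral_add
    (integrable_of_continuous_bdd (by fun_prop) (fun t => Real.abs_sin_le_one _))
    (integrable_of_continuous_bdd (by fun_prop) (fun t => Real.abs_sin_le_one _)),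
    integral_sin_int, integral_sin_int]
  simp

/-- Dominated convergence with majorant `|φ| ∑ c k`. It serves both for the coefficients of a
trigonometric series and for convolutions with a merely summable `φ`. -/
lemma hasSum_integral_mul {φ : ℝ → ℝ} (hφ : Integrable φ periodMeasure) {g : ℕ → ℝ → ℝ}
    {c : ℕ → ℝ} (hc : Summable c) (hg : ∀ k, Continuous (g k)) (hb : ∀ k t, |g k t| ≤ c k) :
    HasSum (fun k => ∫ t, φ t * g k t ∂periodMeasure) (∫ t, φ t * ∑' k, g k t ∂periodMeasure) := by
  have hF : ∀ k, AEStronglyMeasurable (fun t => φ t * g k t) periodMeasure :=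
    fun k => (integrable_mul_of_bound hφ (hg k) (hb k)).aestronglyMeasurable
  have hbd : ∀ k, ∀ᵐ t ∂periodMeasure, ‖φ t * g k t‖ ≤ |φ t| * c k := fun k =>
    Filter.Eventually.of_forall fun t => by
      rw [Real.norm_eq_abs, abs_mul]
      exact mul_le_mul_of_nonneg_left (hb k t) (abs_nonneg _)
  have hs : ∀ᵐ t ∂periodMeasure, Summable fun k => |φ t| * c k :=
    Filter.Eventually.of_forall fun t => hc.mul_left _
  have hi : Integrable (fun t => ∑' k, |φ t| * c k) periodMeasure := by
    simp_rw [tsum_mul_left]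
    exact hφ.abs.mul_const _
  have hsg : ∀ t, Summable fun k => g k t := fun t => Summable.of_norm_bounded hc fun k => hb k t
  have hl : ∀ᵐ t ∂periodMeasure, HasSum (fun k => φ t * g k t) (φ t * ∑' k, g k t) :=
    ae_of_all _ fun t => HasSum.mul_left (φ t) (hsg t).hasSum
  exact hasSum_integral_of_dominated_convergence _ hF hbd hs hi hl

lemma abs_fourierA_le {φ : ℝ → ℝ} (hφ : Integrable φ periodMeasure) (k : ℕ) :
    |fourierA φ k| ≤ (1 / Real.pi) * ∫ t, |φ t| ∂periodMeasure := by
  rw [fourierA_eq, abs_mul, abs_of_pos (by positivity)]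
  gcongr
  refine (abs_integral_le_integral_abs).trans (integral_mono (integrable_mul_cos hφ _).abs hφ.abs ?_)
  intro t
  simp only [abs_mul]
  exact mul_le_of_le_one_right (abs_nonneg _) (Real.abs_cos_le_one _)

lemma abs_fourierB_le {φ : ℝ → ℝ} (hφ : Integrable φ periodMeasure) (k : ℕ) :
    |fourierB φ k| ≤ (1 / Real.pi) * ∫ t, |φ t| ∂periodMeasure := by
  rw [fourierB_eq, abs_mul, abs_of_pos (by positivity)]
  gcongr
  refine (abs_integral_le_integral_abs).trans (integral_mono (integrable_mul_sin hφ _).abs hφ.abs ?_)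
  intro t
  simp only [abs_mul]
  exact mul_le_of_le_one_right (abs_nonneg _) (Real.abs_sin_le_one _)

/-- The trigonometric series with coefficients `A`, `B`. -/
noncomputable def trigSeries (A B : ℕ → ℝ) (x : ℝ) : ℝ :=
  ∑' k : ℕ, (A k * Real.cos (k * x) + B k * Real.sin (k * x))

lemma abs_trig_term_le (a b y : ℝ) : |a * Real.cos y + b * Real.sin y| ≤ |a| + |b| := by
  refine (abs_add_le _ _).trans ?_
  rw [abs_mul, abs_mul]
  exact add_le_add (mul_le_of_le_one_right (abs_nonneg _) (Real.abs_cos_le_one _))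
    (mul_le_of_le_one_right (abs_nonneg _) (Real.abs_sin_le_one _))

section TrigSeries

variable {A B : ℕ → ℝ}

lemma hasSum_trigSeries (h : Summable fun k => |A k| + |B k|) (x : ℝ) :
    HasSum (fun k : ℕ => A k * Real.cos (k * x) + B k * Real.sin (k * x)) (trigSeries A B x) :=
  (Summable.of_norm_bounded h (fun _ => abs_trig_term_le _ _ _)).hasSum

lemma memC_trigSeries (h : Summable fun k => |A k| + |B k|) : MemC (trigSeries A B) := by
  refine ⟨fun x => ?_, ?_⟩
  · unfold trigSeries
    refine tsum_congr fun k => ?_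
    rw [mul_add, Real.cos_add_nat_mul_two_pi, Real.sin_add_nat_mul_two_pi]
  · exact continuous_tsum (fun k => by fun_prop) h (fun k x => abs_trig_term_le _ _ _)

lemma fourierA_trigSeries (h : Summable fun k => |A k| + |B k|) (j : ℕ) :
    fourierA (trigSeries A B) j = if j = 0 then 2 * A 0 else A j := by
  have h1 := hasSum_integral_mul (φ := fun t => Real.cos (j * t))
    (integrable_of_continuous_bdd (by fun_prop) (fun t => Real.abs_cos_le_one _)) h
    (g := fun k t => A k * Real.cos (k * t) + B k * Real.sin (k * t)) (fun k => by fun_prop)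
    (fun k t => abs_trig_term_le _ _ _)
  have h2 : ∀ k : ℕ, ∫ t, Real.cos (j * t) * (A k * Real.cos (k * t) + B k * Real.sin (k * t))
      ∂periodMeasure = if k = j then A j * (if j = 0 then 2 * Real.pi else Real.pi) else 0 := by
    intro k
    have : ∀ t, Real.cos (j * t) * (A k * Real.cos (k * t) + B k * Real.sin (k * t)) =
        A k * (Real.cos (k * t) * Real.cos (j * t)) +
          B k * (Real.sin (k * t) * Real.cos (j * t)) := fun t => by ring
    simp_rw [this]
    rw [integral_add, integral_const_mul, integral_const_mul, integral_cos_mul_cos,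
      integral_sin_mul_cos]
    · split_ifs with h1 <;> simp [h1]
    · exact (integrable_mul_cos (integrable_of_continuous_bdd (by fun_prop)
        (fun t => Real.abs_cos_le_one _)) _).const_mul _
    · exact (integrable_mul_cos (integrable_of_continuous_bdd (by fun_prop)
        (fun t => Real.abs_sin_le_one _)) _).const_mul _
  simp_rw [h2] at h1
  have h3 := h1.unique (hasSum_ite_eq j _)
  rw [fourierA_eq]
  simp_rw [mul_comm (trigSeries A B _)]
  unfold trigSeries
  rw [h3]
  have := Real.pi_ne_zero
  split_ifs with hj
  · subst hj; field_simp
  · field_simp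

lemma fourierB_trigSeries (h : Summable fun k => |A k| + |B k|) {j : ℕ} (hj : j ≠ 0) :
    fourierB (trigSeries A B) j = B j := by
  have h1 := hasSum_integral_mul (φ := fun t => Real.sin (j * t))
    (integrable_of_continuous_bdd (by fun_prop) (fun t => Real.abs_sin_le_one _)) h
    (g := fun k t => A k * Real.cos (k * t) + B k * Real.sin (k * t)) (fun k => by fun_prop)
    (fun k t => abs_trig_term_le _ _ _)
  have h2 : ∀ k : ℕ, ∫ t, Real.sin (j * t) * (A k * Real.cos (k * t) + B k * Real.sin (k * t))
      ∂periodMeasure = if k = j then B j * Real.pi else 0 := by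
    intro k
    have : ∀ t, Real.sin (j * t) * (A k * Real.cos (k * t) + B k * Real.sin (k * t)) =
        A k * (Real.sin (j * t) * Real.cos (k * t)) +
          B k * (Real.sin (k * t) * Real.sin (j * t)) := fun t => by ring
    simp_rw [this]
    rw [integral_add, integral_const_mul, integral_const_mul, integral_sin_mul_cos,
      integral_sin_mul_sin]
    · split_ifs with h1 <;> simp [h1]
    · exact (integrable_mul_cos (integrable_of_continuous_bdd (by fun_prop)
        (fun t => Real.abs_sin_le_one _)) _).const_mul _
    · exact (integrable_mul_sin (integrable_of_continuous_bdd (by fun_prop)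
        (fun t => Real.abs_sin_le_one _)) _).const_mul _
  simp_rw [h2] at h1
  have h3 := h1.unique (hasSum_ite_eq j _)
  rw [fourierB_eq]
  simp_rw [mul_comm (trigSeries A B _)]
  unfold trigSeries
  rw [h3]
  have := Real.pi_ne_zero
  field_simp

end TrigSeries

lemma MemC.integrable {f : ℝ → ℝ} (hf : MemC f) : Integrable f periodMeasure :=
  memLp_one_iff_integrable.1 (memLp_of_continuous_periodic hf.1 hf.2 1)

/-- Vanishing complex Fourier coefficients are summable, so the Fourier series converges pointwise
to the function, and its sum is zero. -/
lemma MemC.eq_zero {f : ℝ → ℝ} (hf : MemC f) (hA : ∀ k, fourierA f k = 0)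
    (hB : ∀ k, k ≠ 0 → fourierB f k = 0) : f = 0 := by
  have hc : Continuous fun x => (f x : ℂ) := Complex.continuous_ofReal.comp hf.2
  have hp : Function.Periodic (fun x => (f x : ℂ)) (2 * Real.pi) := fun x => by simp [hf.1 x]
  obtain ⟨G, hG, hGf⟩ := exists_circle_lift hp hc
  have hA' : ∀ k : ℕ, ∫ t, f t * Real.cos (k * t) ∂periodMeasure = 0 := by
    intro k
    have := hA k
    rw [fourierA_eq] at this
    simpa [Real.pi_ne_zero] using this
  have hB' : ∀ k : ℕ, ∫ t, f t * Real.sin (k * t) ∂periodMeasure = 0 := by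
    intro k
    rcases eq_or_ne k 0 with rfl | hk
    · simp
    have := hB k hk
    rw [fourierB_eq] at this
    simpa [Real.pi_ne_zero] using this
  have hA2 : ∀ k : ℤ, ∫ t, f t * Real.cos (k * t) ∂periodMeasure = 0 := by
    intro k
    rcases Int.eq_nat_or_neg k with ⟨j, rfl | rfl⟩
    · simpa using hA' j
    · simpa using hA' j
  have hB2 : ∀ k : ℤ, ∫ t, f t * Real.sin (k * t) ∂periodMeasure = 0 := by
    intro k
    rcases Int.eq_nat_or_neg k with ⟨j, rfl | rfl⟩
    · simpa using hB' j
    · simpa [integral_neg] using hB' j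
  have h0 : ∀ n : ℤ, fourierCoeff (T := 2 * Real.pi) (⟨G, hG⟩ : C(AddCircle (2 * Real.pi), ℂ)) n
      = 0 := by
    intro n
    rw [fourierCoeff_eq_intervalIntegral _ n 0, zero_add,
      intervalIntegral_eq_integral_periodMeasure]
    have : ∀ x : ℝ, @fourier (2 * Real.pi) (-n) x • (⟨G, hG⟩ : C(AddCircle (2 * Real.pi), ℂ)) x =
        ((f x * Real.cos (n * x) : ℝ) : ℂ) - ((f x * Real.sin (n * x) : ℝ) : ℂ) * Complex.I := by
      intro x
      change fourier (-n) (x : AddCircle (2 * Real.pi)) • G x = _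
      rw [hGf, fourier_coe_apply]
      have e : 2 * (Real.pi : ℂ) * Complex.I * ((-n : ℤ) : ℂ) * x / ((2 * Real.pi : ℝ) : ℂ) =
          ((-(n * x) : ℝ) : ℂ) * Complex.I := by
        have : (Real.pi : ℂ) ≠ 0 := by exact_mod_cast Real.pi_ne_zero
        push_cast
        field_simp
      rw [e, Complex.exp_mul_I, ← Complex.ofReal_cos, ← Complex.ofReal_sin, Real.cos_neg,
        Real.sin_neg]
      push_cast
      simp only [smul_eq_mul]
      ring
    simp_rw [this]
    rw [integral_sub (integrable_mul_cos hf.integrable _).ofReal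
      ((integrable_mul_sin hf.integrable _).ofReal.mul_const _), integral_mul_const,
      integral_complex_ofReal, integral_complex_ofReal, hA2, hB2]
    simp
  have hs : Summable (fourierCoeff (T := 2 * Real.pi)
      (⟨G, hG⟩ : C(AddCircle (2 * Real.pi), ℂ))) := by
    rw [show fourierCoeff (T := 2 * Real.pi) (⟨G, hG⟩ : C(AddCircle (2 * Real.pi), ℂ)) = 0 from
      funext h0]
    exact summable_zero
  funext x
  have h1 := has_pointwise_sum_fourier_series_of_summable hs (x : AddCircle (2 * Real.pi))
  simp_rw [h0, zero_smul] at h1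
  have h2 := h1.unique hasSum_zero
  rw [ContinuousMap.coe_mk, hGf] at h2
  exact_mod_cast h2

lemma MemC.eq_of_fourier_eq {f g : ℝ → ℝ} (hf : MemC f) (hg : MemC g)
    (hA : ∀ k, fourierA f k = fourierA g k) (hB : ∀ k, k ≠ 0 → fourierB f k = fourierB g k) :
    f = g := by
  have hm : MemC (fun x => f x - g x) :=
    ⟨fun x => by simp only [hf.1 x, hg.1 x], hf.2.sub hg.2⟩
  have := hm.eq_zero (fun k => ?_) (fun k hk => ?_)
  · funext x
    exact sub_eq_zero.1 (congrFun this x)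
  · have h := hA k
    rw [fourierA_eq, fourierA_eq] at h
    rw [fourierA_eq]
    simp_rw [sub_mul]
    rw [integral_sub (integrable_mul_cos hf.integrable _) (integrable_mul_cos hg.integrable _),
      mul_sub, h, sub_self]
  · have h := hB k hk
    rw [fourierB_eq, fourierB_eq] at h
    rw [fourierB_eq]
    simp_rw [sub_mul]
    rw [integral_sub (integrable_mul_sin hf.integrable _) (integrable_mul_sin hg.integrable _),
      mul_sub, h, sub_self]

/-! ### Convolution kernels and the de la Vallée Poussin weights -/

/-- The kernel `∑ μ(k) cos (k t - b)`. -/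
noncomputable def kern (μ : ℕ → ℝ) (b t : ℝ) : ℝ := ∑' k : ℕ, μ k * Real.cos (k * t - b)

section Kern

variable {μ : ℕ → ℝ} {b : ℝ}

lemma abs_mul_cos_le (a y : ℝ) : |a * Real.cos y| ≤ |a| := by
  rw [abs_mul]
  exact mul_le_of_le_one_right (abs_nonneg _) (Real.abs_cos_le_one _)

lemma hasSum_kern (h : Summable fun k => |μ k|) (b t : ℝ) :
    HasSum (fun k : ℕ => μ k * Real.cos (k * t - b)) (kern μ b t) :=
  (Summable.of_norm_bounded h (fun _ => abs_mul_cos_le _ _)).hasSum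

lemma memC_kern (h : Summable fun k => |μ k|) (b : ℝ) : MemC (kern μ b) := by
  refine ⟨fun x => ?_, ?_⟩
  · unfold kern
    refine tsum_congr fun k => ?_
    rw [mul_add, add_sub_right_comm, Real.cos_add_nat_mul_two_pi]
  · exact continuous_tsum (fun k => by fun_prop) h (fun k x => abs_mul_cos_le _ _)

/-- Convolution with `kern μ b` in terms of the Fourier coefficients. -/
lemma hasSum_conv_kern (h : Summable fun k => |μ k|) (b : ℝ) {φ : ℝ → ℝ}
    (hφ : Integrable φ periodMeasure) (x : ℝ) :
    HasSum (fun k : ℕ => μ k * (fourierA φ k * Real.cos (k * x - b) +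
        fourierB φ k * Real.sin (k * x - b)))
      ((1 / Real.pi) * ∫ t, φ t * kern μ b (x - t) ∂periodMeasure) := by
  have h1 := (hasSum_integral_mul hφ h
    (g := fun k t => μ k * Real.cos (k * (x - t) - b)) (fun k => by fun_prop)
    (fun k t => abs_mul_cos_le _ _)).mul_left (1 / Real.pi)
  convert! h1 using 2 with k
  have e : ∀ t, φ t * (μ k * Real.cos (k * (x - t) - b)) =
      (μ k * Real.cos (k * x - b)) * (φ t * Real.cos (k * t)) +
        (μ k * Real.sin (k * x - b)) * (φ t * Real.sin (k * t)) := by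
    intro t
    rw [show (k : ℝ) * (x - t) - b = (k * x - b) - k * t by ring, Real.cos_sub]
    ring
  simp_rw [e]
  rw [integral_add ((integrable_mul_cos hφ _).const_mul _) ((integrable_mul_sin hφ _).const_mul _),
    integral_const_mul, integral_const_mul, fourierA_eq, fourierB_eq]
  ring

end Kern

lemma fourierSum_trigSeries {A B : ℕ → ℝ} (h : Summable fun k => |A k| + |B k|) (k : ℕ) (x : ℝ) :
    fourierSum (trigSeries A B) k x =
      ∑ j ∈ Finset.range (k + 1), (A j * Real.cos (j * x) + B j * Real.sin (j * x)) := by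
  rw [fourierSum, fourierA_trigSeries h, Finset.range_eq_Ico,
    Finset.sum_eq_sum_Ico_succ_bot (Nat.succ_pos k), if_pos rfl]
  congr 1
  · simp
  · refine Finset.sum_congr (by ext; simp only [Finset.mem_Icc, Finset.mem_Ico]; omega) fun j hj => ?_
    have hj0 : j ≠ 0 := by have := Finset.mem_Icc.1 hj; omega
    rw [fourierA_trigSeries h, fourierB_trigSeries h hj0, if_neg hj0]

/-- `p` times the complement of the de la Vallée Poussin multiplier. -/
def vpWeight (n p k : ℕ) : ℕ := min p (k - (n - p))

lemma vpWeight_le (n p k : ℕ) : vpWeight n p k ≤ p := min_le_left _ _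

lemma vpWeight_eq_zero {n p k : ℕ} (h : k ≤ n - p) : vpWeight n p k = 0 := by
  unfold vpWeight; omega

lemma vpWeight_add (n p j : ℕ) : vpWeight n p (j + (n - p + 1)) = min p (j + 1) := by
  unfold vpWeight; omega

/-- The sum counts the indices `i` in `[n-p, n)` with `i < k`, that is, the averaged partial sums
that omit the `k`-th harmonic. -/
lemma sum_Ico_indicator {n p : ℕ} (hpn : p ≤ n) (k : ℕ) (c : ℝ) :
    ∑ i ∈ Finset.Ico (n - p) n, (if k ∈ Finset.range (i + 1) then 0 else c) =
      vpWeight n p k * c := by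
  have : ∀ i, (if k ∈ Finset.range (i + 1) then 0 else c) = if i < k then c else 0 := by
    intro i; simp only [Finset.mem_range]; split_ifs <;> first | rfl | omega
  simp_rw [this]
  rw [← Finset.sum_filter, Finset.sum_const, nsmul_eq_mul]
  congr 2
  have : (Finset.Ico (n - p) n).filter (· < k) = Finset.Ico (n - p) (min n k) := by
    ext; simp only [Finset.mem_filter, Finset.mem_Ico]; omega
  rw [this, Nat.card_Ico, vpWeight]
  omega

lemma hasSum_rho_trigSeries {A B : ℕ → ℝ} (h : Summable fun k => |A k| + |B k|) {n p : ℕ}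
    (hp : 1 ≤ p) (hpn : p ≤ n) (x : ℝ) :
    HasSum (fun k : ℕ => (1 / (p : ℝ)) *
        (vpWeight n p k * (A k * Real.cos (k * x) + B k * Real.sin (k * x))))
      (rho n p (trigSeries A B) x) := by
  have h0 := hasSum_trigSeries h x
  have h1 : ∀ i : ℕ, HasSum (fun k : ℕ => if k ∈ Finset.range (i + 1) then 0 else
      (A k * Real.cos (k * x) + B k * Real.sin (k * x)))
      (trigSeries A B x - fourierSum (trigSeries A B) i x) := by
    intro i
    rw [fourierSum_trigSeries h]
    have h2 := hasSum_sum_of_ne_finset_zero (L := SummationFilter.unconditional ℕ) (s := Finset.range (i + 1))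
      (f := fun k : ℕ => if k ∈ Finset.range (i + 1) then
        (A k * Real.cos (k * x) + B k * Real.sin (k * x)) else 0)
      (fun b hb => if_neg hb)
    rw [Finset.sum_congr rfl (fun j hj => if_pos hj)] at h2
    convert! h0.sub h2 using 2 with k
    split_ifs <;> simp
  have h2 := (hasSum_sum (s := Finset.Ico (n - p) n) (fun i _ => h1 i)).mul_left (1 / (p : ℝ))
  simp_rw [sum_Ico_indicator hpn] at h2
  convert! h2 using 1
  rw [Finset.sum_sub_distrib, Finset.sum_const, Nat.card_Ico, rho, vpSum, mul_sub,
    Nat.sub_sub_self hpn, nsmul_eq_mul]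
  have : (p : ℝ) ≠ 0 := by positivity
  field_simp

/-! ### Recovering a function from its derivative; integral form of the deviation -/

/-- The trigonometric series of a function with `(ψ, β)`-derivative `φ` and mean value `c`. -/
noncomputable def psiInt (ψ : ℕ → ℝ) (β c : ℝ) (φ : ℝ → ℝ) : ℝ → ℝ :=
  trigSeries
    (fun k => if k = 0 then c else ψ k * (fourierA φ k * Real.cos (β * Real.pi / 2) -
      fourierB φ k * Real.sin (β * Real.pi / 2)))
    (fun k => ψ k * (fourierB φ k * Real.cos (β * Real.pi / 2) +
      fourierA φ k * Real.sin (β * Real.pi / 2)))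

section PsiInt

variable {ψ : ℕ → ℝ} {β : ℝ} {f φ : ℝ → ℝ}

lemma summable_psiInt (hψ : Summable ψ) (hpos : ∀ k, 0 < ψ k) (hφ : Integrable φ periodMeasure)
    (β c : ℝ) :
    Summable fun k => |if k = 0 then c else ψ k * (fourierA φ k * Real.cos (β * Real.pi / 2) -
      fourierB φ k * Real.sin (β * Real.pi / 2))| +
      |ψ k * (fourierB φ k * Real.cos (β * Real.pi / 2) +
      fourierA φ k * Real.sin (β * Real.pi / 2))| := by
  set C := (1 / Real.pi) * ∫ t, |φ t| ∂periodMeasure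
  have key : ∀ k, ∀ a b : ℝ, |a| ≤ C → |b| ≤ C → ∀ y : ℝ,
      |ψ k * (a * Real.cos y + b * Real.sin y)| ≤ ψ k * (C + C) := by
    intro k a b ha hb y
    rw [abs_mul, abs_of_pos (hpos k)]
    exact mul_le_mul_of_nonneg_left ((abs_trig_term_le _ _ _).trans (add_le_add ha hb)) (hpos k).le
  have h1 : Summable fun k => (if k = 0 then |c| else 0) + ψ k * (C + C) + ψ k * (C + C) :=
    ((hasSum_ite_eq 0 |c|).summable.add (hψ.mul_right _)).add (hψ.mul_right _)
  refine Summable.of_nonneg_of_le (fun k => by positivity) (fun k => ?_) h1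
  have hA := abs_fourierA_le hφ k
  have hB := abs_fourierB_le hφ k
  refine add_le_add ?_ (key k _ _ hB hA _)
  split_ifs with hk
  · have := (abs_nonneg _).trans hA
    have := (hpos k).le
    have : 0 ≤ ψ k * (C + C) := by positivity
    linarith
  · have := key k _ (-fourierB φ k) hA (by rwa [abs_neg]) (β * Real.pi / 2)
    rw [neg_mul, ← sub_eq_add_neg] at this
    linarith

lemma isPsiBetaDeriv_psiInt (hψ : Summable ψ) (hpos : ∀ k, 0 < ψ k) (hφ : MemL 1 φ)
    (h0 : fourierA φ 0 = 0) (β c : ℝ) : IsPsiBetaDeriv ψ β (psiInt ψ β c φ) φ := by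
  have hi := memLp_one_iff_integrable.1 hφ.2
  have hs := summable_psiInt hψ hpos hi β c
  have hC : MemC (psiInt ψ β c φ) := memC_trigSeries hs
  refine ⟨⟨hC.1, memLp_of_continuous_periodic hC.1 hC.2 _⟩, hφ, h0, fun k hk x => ?_⟩
  have hk0 : k ≠ 0 := by omega
  unfold psiInt
  rw [fourierA_trigSeries hs, fourierB_trigSeries hs hk0, if_neg hk0, if_neg hk0, Real.cos_add,
    Real.sin_add]
  have := (hpos k).ne'
  have h2 := Real.sin_sq_add_cos_sq (β * Real.pi / 2)
  field_simp
  linear_combination (-(fourierA φ k * Real.cos (k * x)) - fourierB φ k * Real.sin (k * x)) * h2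

/-- The derivative rotates each coefficient pair by `βπ/2` and divides by `ψ k`; inverting this
determines all coefficients of `f` except the mean, and a continuous function is determined by its
coefficients. -/
lemma eq_psiInt (hψ : Summable ψ) (hpos : ∀ k, 0 < ψ k) (hf : MemC f)
    (h : IsPsiBetaDeriv ψ β f φ) : f = psiInt ψ β (fourierA f 0 / 2) φ := by
  obtain ⟨-, hφ, h0, hk⟩ := h
  have hi := memLp_one_iff_integrable.1 hφ.2
  have hs := summable_psiInt hψ hpos hi β (fourierA f 0 / 2)
  have h2 := Real.sin_sq_add_cos_sq (β * Real.pi / 2)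
  have key : ∀ k : ℕ, k ≠ 0 →
      fourierA φ k = (1 / ψ k) * (fourierA f k * Real.cos (β * Real.pi / 2) +
        fourierB f k * Real.sin (β * Real.pi / 2)) ∧
      fourierB φ k = (1 / ψ k) * (fourierB f k * Real.cos (β * Real.pi / 2) -
        fourierA f k * Real.sin (β * Real.pi / 2)) := by
    intro k hk0
    have hkR : (k : ℝ) ≠ 0 := Nat.cast_ne_zero.2 hk0
    constructor
    · simpa using hk k (by omega) 0
    -- Evaluation at `x = 0` isolated the cosine coefficient; `x = π/(2k)` isolates the sine
    -- coefficient.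
    · have := hk k (by omega) (Real.pi / 2 / k)
      rw [mul_div_cancel₀ _ hkR, Real.cos_pi_div_two, Real.sin_pi_div_two, add_comm (Real.pi / 2),
        Real.cos_add_pi_div_two, Real.sin_add_pi_div_two] at this
      linarith
  refine hf.eq_of_fourier_eq (memC_trigSeries hs) (fun k => ?_) (fun k hk0 => ?_)
  · rw [psiInt, fourierA_trigSeries hs, if_pos rfl]
    split_ifs with hk0
    · rw [hk0]; ring
    · obtain ⟨e1, e2⟩ := key k hk0
      rw [e1, e2]
      have := (hpos k).ne'
      field_simp
      linear_combination (-fourierA f k) * h2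
  · rw [psiInt, fourierB_trigSeries hs hk0]
    obtain ⟨e1, e2⟩ := key k hk0
    rw [e1, e2]
    have := (hpos k).ne'
    field_simp
    linear_combination (-fourierB f k) * h2

/-- The convolution kernel of `p ρ_{n,p}` with respect to the `(ψ, β)`-derivative. -/
noncomputable def vpKern (ψ : ℕ → ℝ) (β : ℝ) (n p : ℕ) : ℝ → ℝ :=
  kern (fun k => vpWeight n p k * ψ k) (β * Real.pi / 2)

lemma summable_vpKern (hψ : Summable ψ) (hpos : ∀ k, 0 < ψ k) (n p : ℕ) :
    Summable fun k => |(vpWeight n p k : ℝ) * ψ k| := by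
  refine Summable.of_nonneg_of_le (fun k => abs_nonneg _) (fun k => ?_) (hψ.mul_left (p : ℝ))
  rw [abs_mul, abs_of_pos (hpos k), Nat.abs_cast]
  have := (hpos k).le
  gcongr
  exact vpWeight_le _ _ _

lemma rho_eq_integral (hψ : Summable ψ) (hpos : ∀ k, 0 < ψ k) (hf : MemC f)
    (h : IsPsiBetaDeriv ψ β f φ) {n p : ℕ} (hp : 1 ≤ p) (hpn : p ≤ n) (x : ℝ) :
    rho n p f x = (1 / (p * Real.pi)) * ∫ t, φ t * vpKern ψ β n p (x - t) ∂periodMeasure := by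
  have hi := memLp_one_iff_integrable.1 h.2.1.2
  have hs := summable_psiInt hψ hpos hi β (fourierA f 0 / 2)
  have h1 := hasSum_rho_trigSeries hs hp hpn x
  have h2 := (hasSum_conv_kern (summable_vpKern hψ hpos n p) (β * Real.pi / 2) hi x).mul_left
    (1 / (p : ℝ))
  conv_lhs => rw [eq_psiInt hψ hpos hf h]
  rw [psiInt]
  refine (h1.unique ?_).trans (b := (1 / (p : ℝ)) * ((1 / Real.pi) *
    ∫ t, φ t * vpKern ψ β n p (x - t) ∂periodMeasure)) (by ring)
  convert! h2 using 2 with k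
  rcases eq_or_ne k 0 with rfl | hk
  · simp [vpWeight_eq_zero]
  · rw [if_neg hk, Real.cos_sub, Real.sin_sub]
    ring

end PsiInt

/-! ### Orthogonality of the kernel to low-order polynomials, and best approximation -/

section Orthogonality

lemma memC_trigPoly {m : ℕ} {T : ℝ → ℝ} (hT : T ∈ trigPoly m) : MemC T := by
  obtain ⟨c, d, h⟩ := hT
  have : T = fun x => ∑ k ∈ Finset.range m, (c k * Real.cos (k * x) + d k * Real.sin (k * x)) :=
    funext h
  subst this
  refine ⟨fun x => ?_, by fun_prop⟩
  refine Finset.sum_congr rfl fun k _ => ?_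
  rw [mul_add, Real.cos_add_nat_mul_two_pi, Real.sin_add_nat_mul_two_pi]

lemma trigPoly_eq_trigSeries {m : ℕ} {T : ℝ → ℝ} (hT : T ∈ trigPoly m) :
    ∃ A B : ℕ → ℝ, (∀ k, m ≤ k → A k = 0 ∧ B k = 0) ∧ (Summable fun k => |A k| + |B k|) ∧
      T = trigSeries A B := by
  obtain ⟨c, d, h⟩ := hT
  refine ⟨fun k => if k < m then c k else 0, fun k => if k < m then d k else 0,
    fun k hk => ⟨if_neg (by omega), if_neg (by omega)⟩, ?_, ?_⟩
  · refine summable_of_ne_finset_zero (s := Finset.range m) fun k hk => ?_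
    have : ¬ k < m := by simpa using hk
    simp [this]
  · funext x
    rw [h, trigSeries, tsum_eq_sum (s := Finset.range m)]
    · refine Finset.sum_congr rfl fun k hk => ?_
      rw [if_pos (Finset.mem_range.1 hk), if_pos (Finset.mem_range.1 hk)]
    · intro k hk
      have : ¬ k < m := by simpa using hk
      simp [this]

lemma integral_trigPoly_mul_vpKern {ψ : ℕ → ℝ} (hψ : Summable ψ) (hpos : ∀ k, 0 < ψ k) (β : ℝ)
    (n p : ℕ) {T : ℝ → ℝ} (hT : T ∈ trigPoly (n - p + 1)) (x : ℝ) :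
    ∫ t, T t * vpKern ψ β n p (x - t) ∂periodMeasure = 0 := by
  obtain ⟨A, B, hAB, hs, rfl⟩ := trigPoly_eq_trigSeries hT
  have h := hasSum_conv_kern (summable_vpKern hψ hpos n p) (β * Real.pi / 2)
    (memC_trigSeries hs).integrable x
  have h3 : (fun k : ℕ => (vpWeight n p k : ℝ) * ψ k * (fourierA (trigSeries A B) k *
      Real.cos (k * x - β * Real.pi / 2) + fourierB (trigSeries A B) k *
      Real.sin (k * x - β * Real.pi / 2))) = fun _ => 0 := by
    funext k
    rcases le_or_gt k (n - p) with hk | hk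
    · simp [vpWeight_eq_zero hk]
    · obtain ⟨hA, hB⟩ := hAB k (by omega)
      rw [fourierA_trigSeries hs, fourierB_trigSeries hs (by omega), if_neg (by omega), hA, hB]
      simp
  rw [h3] at h
  have := h.unique hasSum_zero
  simpa [Real.pi_ne_zero, vpKern] using this

end Orthogonality

section BestApprox

variable {m : ℕ} {s : ENNReal} {φ : ℝ → ℝ}

lemma trigPoly_add {T U : ℝ → ℝ} (hT : T ∈ trigPoly m) (hU : U ∈ trigPoly m) :
    (fun x => T x + U x) ∈ trigPoly m := by
  obtain ⟨c, d, h⟩ := hT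
  obtain ⟨c', d', h'⟩ := hU
  refine ⟨fun k => c k + c' k, fun k => d k + d' k, fun x => ?_⟩
  simp only [h, h', ← Finset.sum_add_distrib]
  exact Finset.sum_congr rfl fun k _ => by ring

lemma trigPoly_const_mul (a : ℝ) {T : ℝ → ℝ} (hT : T ∈ trigPoly m) :
    (fun x => a * T x) ∈ trigPoly m := by
  obtain ⟨c, d, h⟩ := hT
  refine ⟨fun k => a * c k, fun k => a * d k, fun x => ?_⟩
  simp only [h, Finset.mul_sum]
  exact Finset.sum_congr rfl fun k _ => by ring

lemma trigPoly_const (hm : 1 ≤ m) (a : ℝ) : (fun _ => a) ∈ trigPoly m := by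
  refine ⟨fun k => if k = 0 then a else 0, fun _ => 0, fun x => ?_⟩
  rw [Finset.sum_eq_single_of_mem 0 (Finset.mem_range.2 hm)]
  · simp
  · intro k _ hk; simp [hk]

lemma trigPoly_zero : (fun _ => 0) ∈ trigPoly m := ⟨fun _ => 0, fun _ => 0, fun x => by simp⟩

lemma bddBelow_bestApprox :
    BddBelow ((fun t : ℝ → ℝ => normL s (fun x => φ x - t x)) '' trigPoly m) :=
  ⟨0, by rintro _ ⟨t, -, rfl⟩; exact normL_nonneg _ _⟩

lemma bestApprox_nonneg : 0 ≤ bestApprox m s φ :=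
  Real.sInf_nonneg (by rintro _ ⟨t, -, rfl⟩; exact normL_nonneg _ _)

lemma bestApprox_le {T : ℝ → ℝ} (hT : T ∈ trigPoly m) :
    bestApprox m s φ ≤ normL s (fun x => φ x - T x) :=
  csInf_le bddBelow_bestApprox ⟨T, hT, rfl⟩

lemma bestApprox_le_normL : bestApprox m s φ ≤ normL s φ := by
  simpa using bestApprox_le (φ := φ) (s := s) (m := m) trigPoly_zero

lemma le_bestApprox {a : ℝ} (h : ∀ T ∈ trigPoly m, a ≤ normL s (fun x => φ x - T x)) :
    a ≤ bestApprox m s φ :=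
  le_csInf (Set.Nonempty.image _ ⟨_, trigPoly_zero⟩) (by rintro _ ⟨t, ht, rfl⟩; exact h t ht)

lemma normL_const_mul (a : ℝ) (f : ℝ → ℝ) : normL s (fun x => a * f x) = |a| * normL s f := by
  have : (fun x => a * f x) = a • f := rfl
  rw [normL, this, eLpNorm_const_smul, ENNReal.toReal_mul, toReal_enorm, Real.norm_eq_abs, normL]

lemma bestApprox_const_mul {a : ℝ} (ha : 0 < a) :
    bestApprox m s (fun x => a * φ x) = a * bestApprox m s φ := by
  apply le_antisymm
  · rw [← div_le_iff₀' ha]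
    refine le_bestApprox fun T hT => ?_
    rw [div_le_iff₀' ha]
    refine (bestApprox_le (trigPoly_const_mul a hT)).trans (le_of_eq ?_)
    simp_rw [← mul_sub]
    rw [normL_const_mul, abs_of_pos ha]
  · refine le_bestApprox fun T hT => ?_
    have := bestApprox_le (φ := φ) (s := s) (trigPoly_const_mul a⁻¹ hT)
    calc a * bestApprox m s φ ≤ |a| * normL s (fun x => φ x - a⁻¹ * T x) := by
          rw [abs_of_pos ha]; gcongr
      _ = _ := by
          rw [← normL_const_mul]
          congr 1
          funext x
          field_simp

lemma bestApprox_sub_trigPoly {U : ℝ → ℝ} (hU : U ∈ trigPoly m) :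
    bestApprox m s (fun x => φ x - U x) = bestApprox m s φ := by
  apply le_antisymm
  · refine le_bestApprox fun T hT => ?_
    refine (bestApprox_le (trigPoly_add hT (trigPoly_const_mul (-1) hU))).trans (le_of_eq ?_)
    congr 1
    funext x
    ring
  · refine le_bestApprox fun T hT => ?_
    refine (bestApprox_le (trigPoly_add hT hU)).trans (le_of_eq ?_)
    congr 1
    funext x
    ring

end BestApprox

/-! ### Duality: the upper bound and nearly norming functions -/

/-- The sharp upper bound of the convolution through the best approximation. -/
lemma abs_integral_mul_vpKern_le {ψ : ℕ → ℝ} (hψ : Summable ψ) (hpos : ∀ k, 0 < ψ k) (β : ℝ)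
    (n p : ℕ) {s u : ENNReal} (h : ENNReal.HolderConjugate s u) {φ : ℝ → ℝ}
    (hφ : MemLp φ s periodMeasure) (x : ℝ) :
    |∫ t, φ t * vpKern ψ β n p (x - t) ∂periodMeasure| ≤
      bestApprox (n - p + 1) s φ * normL u (vpKern ψ β n p) := by
  have hK : MemC (vpKern ψ β n p) := memC_kern (summable_vpKern hψ hpos n p) _
  have hKc : Continuous fun t => vpKern ψ β n p (x - t) := hK.2.comp (by fun_prop)
  have hKx : MemC fun t => vpKern ψ β n p (x - t) := by
    refine ⟨fun t => ?_, hKc⟩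
    simp only
    rw [← hK.1 (x - (t + 2 * Real.pi))]
    congr 1; ring
  have hn : normL u (fun t => vpKern ψ β n p (x - t)) = normL u (vpKern ψ β n p) := by
    rw [normL, eLpNorm_comp_sub_left hK.1 hK.2, normL]
  have key : ∀ T ∈ trigPoly (n - p + 1), |∫ t, φ t * vpKern ψ β n p (x - t) ∂periodMeasure| ≤
      normL s (fun t => φ t - T t) * normL u (vpKern ψ β n p) := by
    intro T hT
    have hTL : MemLp T s periodMeasure :=
      memLp_of_continuous_periodic (memC_trigPoly hT).1 (memC_trigPoly hT).2 s
    have hKL := memLp_of_continuous_periodic hKx.1 hKx.2 u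
    have h1 := abs_integral_mul_le h (hφ.sub hTL) hKL
    rw [hn] at h1
    have h2 : ∫ t, (φ - T) t * vpKern ψ β n p (x - t) ∂periodMeasure =
        ∫ t, φ t * vpKern ψ β n p (x - t) ∂periodMeasure := by
      simp_rw [Pi.sub_apply, sub_mul]
      rw [integral_sub, integral_trigPoly_mul_vpKern hψ hpos β n p hT, sub_zero]
      · exact (hφ.integrable_mul hKL)
      · exact (hTL.integrable_mul hKL)
    rw [h2] at h1
    exact h1
  -- The infimum over `T` is taken after dividing by the kernel norm, so a zero norm is treated
  -- apart, with `T = 0`.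
  rcases (normL_nonneg u (vpKern ψ β n p)).eq_or_lt with h0 | h0
  · have := key _ trigPoly_zero
    rw [← h0, mul_zero] at this ⊢
    exact this
  · rw [← div_le_iff₀ h0]
    refine le_bestApprox fun T hT => ?_
    rw [div_le_iff₀ h0]
    exact key T hT

/-- A sign of `x` that never vanishes. -/
noncomputable def unitSign (x : ℝ) : ℝ := if 0 ≤ x then 1 else -1

lemma abs_unitSign (x : ℝ) : |unitSign x| = 1 := by unfold unitSign; split_ifs <;> simp

lemma unitSign_mul_self (x : ℝ) : unitSign x * x = |x| := by
  unfold unitSign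
  split_ifs with h
  · rw [one_mul, abs_of_nonneg h]
  · rw [abs_of_neg (not_le.1 h)]; ring

lemma measurable_unitSign : Measurable unitSign :=
  Measurable.ite measurableSet_Ici measurable_const measurable_const

/-- The norm of a continuous function is almost attained by duality. -/
lemma exists_near_norming {s u : ENNReal} (h : ENNReal.HolderConjugate s u) {K : ℝ → ℝ}
    (hK : MemC K) {c : ℝ} (hc : c < normL u K) :
    ∃ Φ : ℝ → ℝ, Function.Periodic Φ (2 * Real.pi) ∧ MemLp Φ s periodMeasure ∧
      normL s Φ ≤ 1 ∧ c ≤ ∫ t, Φ t * K t ∂periodMeasure := by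
  have hKm : Measurable K := hK.2.measurable
  have hsm : Measurable fun t => unitSign (K t) := measurable_unitSign.comp hKm
  rcases lt_or_ge c 0 with hc0 | hc0
  · exact ⟨fun _ => 0, fun _ => rfl, MemLp.zero, by simp [normL], by simpa using hc0.le⟩
  have hKL := memLp_of_continuous_periodic hK.1 hK.2 u
  -- For `u = ∞` a norming function in `L_1` need not exist; the normalised sign of `K` on the set
  -- `|K| > c`, which has positive measure, suffices.
  rcases eq_or_ne u ⊤ with rfl | huTop
  · have hs : s = 1 := (ENNReal.HolderConjugate.eq_top_iff_eq_one ⊤ s).1 rfl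
    subst hs
    set S : Set ℝ := {t | c < |K t|} with hS
    have hSm : MeasurableSet S := measurableSet_lt measurable_const hKm.abs
    have hSpos : periodMeasure S ≠ 0 := by
      intro h0
      have h1 : ∀ᵐ t ∂periodMeasure, ‖K t‖ ≤ c := by
        rw [ae_iff]; simpa [hS] using h0
      have h2 := eLpNorm_le_of_ae_bound (p := ⊤) h1
      simp only [ENNReal.toReal_top, inv_zero, ENNReal.rpow_zero, one_mul] at h2
      have h3 := ENNReal.toReal_mono ENNReal.ofReal_ne_top h2
      rw [ENNReal.toReal_ofReal hc0] at h3
      exact absurd hc (not_lt.2 h3)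
    have hSr : 0 < periodMeasure.real S :=
      ENNReal.toReal_pos hSpos (measure_ne_top _ _)
    set M := periodMeasure.real S with hM
    have hint : ∀ t, |S.indicator (fun t => M⁻¹ * unitSign (K t)) t| =
        S.indicator (fun _ => M⁻¹) t := by
      intro t
      by_cases ht : t ∈ S
      · simp [ht, abs_mul, abs_unitSign, hSr.le]
      · simp [ht]
    have hmeas : AEStronglyMeasurable (S.indicator (fun t => M⁻¹ * unitSign (K t)))
        periodMeasure := ((measurable_const.mul hsm).indicator hSm).aestronglyMeasurable
    have hmem : MemLp (S.indicator (fun t => M⁻¹ * unitSign (K t))) 1 periodMeasure := by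
      refine MemLp.of_bound hmeas M⁻¹ (Filter.Eventually.of_forall fun t => ?_)
      rw [Real.norm_eq_abs, hint]
      exact Set.indicator_le_self' (fun _ _ => by positivity) t
    refine ⟨S.indicator (fun t => M⁻¹ * unitSign (K t)), fun t => ?_, hmem, ?_, ?_⟩
    · have : t + 2 * Real.pi ∈ S ↔ t ∈ S := by simp [hS, hK.1 t]
      by_cases ht : t ∈ S
      · rw [Set.indicator_of_mem ht, Set.indicator_of_mem (this.2 ht), hK.1 t]
      · rw [Set.indicator_of_notMem ht, Set.indicator_of_notMem (this.not.2 ht)]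
    · rw [normL, eLpNorm_one_eq_lintegral_enorm, ← integral_norm_eq_lintegral_enorm hmeas]
      simp_rw [Real.norm_eq_abs, hint]
      rw [integral_indicator hSm, setIntegral_const, smul_eq_mul, ← hM, mul_inv_cancel₀ hSr.ne']
    · have e : ∀ t, S.indicator (fun t => M⁻¹ * unitSign (K t)) t * K t =
          S.indicator (fun t => M⁻¹ * |K t|) t := by
        intro t
        by_cases ht : t ∈ S
        · rw [Set.indicator_of_mem ht, Set.indicator_of_mem ht, mul_assoc, unitSign_mul_self]
        · simp [ht]
      simp_rw [e]
      have hKi : Integrable K periodMeasure := hK.integrable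
      calc c = ∫ t, S.indicator (fun _ => M⁻¹ * c) t ∂periodMeasure := by
            rw [integral_indicator hSm, setIntegral_const, smul_eq_mul, ← hM,
              mul_inv_cancel_left₀ hSr.ne']
        _ ≤ _ := by
            refine integral_mono ((integrable_const _).indicator hSm)
              ((hKi.abs.const_mul _).indicator hSm) fun t => Set.indicator_le_indicator' fun ht => ?_
            have : c < |K t| := ht
            gcongr
  -- For `s = ∞` the sign of `K` is exactly norming; for finite exponents the equality case of
  -- Hölder, `|K|^(r-1)` times the sign, is normalised.
  rcases eq_or_ne s ⊤ with rfl | hsTop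
  · have hu : u = 1 := (ENNReal.HolderConjugate.eq_top_iff_eq_one ⊤ u).1 rfl
    subst hu
    have hbd : ∀ᵐ t ∂periodMeasure, ‖unitSign (K t)‖ ≤ 1 :=
      Filter.Eventually.of_forall fun t => (abs_unitSign _).le
    refine ⟨fun t => unitSign (K t), fun t => by simp only [hK.1 t],
      MemLp.of_bound hsm.aestronglyMeasurable 1 hbd, ?_, ?_⟩
    · have := ENNReal.toReal_mono (by simp) (eLpNorm_le_of_ae_bound (p := ⊤) hbd)
      simpa [normL] using this
    · simp_rw [unitSign_mul_self]
      rw [normL, eLpNorm_one_eq_lintegral_enorm,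
        ← integral_norm_eq_lintegral_enorm hKL.aestronglyMeasurable] at hc
      exact hc.le
  · have hr : Real.HolderConjugate s.toReal u.toReal :=
      ENNReal.HolderConjugate.toReal_of_ne_top hsTop huTop
    set r := u.toReal
    set v := s.toReal
    have hu0 : u ≠ 0 := h.symm.ne_zero
    have hs0 : s ≠ 0 := h.ne_zero
    have hr1 : 0 ≤ r - 1 := by linarith [hr.symm.lt]
    have hmeas : Measurable fun t => |K t| ^ (r - 1) * unitSign (K t) :=
      ((hKm.abs).pow_const _).mul hsm
    obtain ⟨x₀, hx₀⟩ := exists_forall_norm_le hK.1 hK.2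
    have habs : ∀ t, ‖|K t| ^ (r - 1) * unitSign (K t)‖ = |K t| ^ (r - 1) := by
      intro t
      rw [Real.norm_eq_abs, abs_mul, abs_unitSign, mul_one, abs_of_nonneg (by positivity)]
    have hmem : MemLp (fun t => |K t| ^ (r - 1) * unitSign (K t)) s periodMeasure := by
      refine MemLp.of_bound hmeas.aestronglyMeasurable (|K x₀| ^ (r - 1))
        (Filter.Eventually.of_forall fun t => ?_)
      rw [habs]
      exact Real.rpow_le_rpow (abs_nonneg _) (hx₀ t) hr1
    set I := ∫ t, |K t| ^ r ∂periodMeasure with hI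
    have hI0 : 0 ≤ I := integral_nonneg fun t => by positivity
    have hN : normL u K = I ^ r⁻¹ := by
      rw [normL, hKL.eLpNorm_eq_integral_rpow_norm hu0 huTop, ENNReal.toReal_ofReal (by positivity)]
      rfl
    have hΦ0 : normL s (fun t => |K t| ^ (r - 1) * unitSign (K t)) = I ^ v⁻¹ := by
      rw [normL, hmem.eLpNorm_eq_integral_rpow_norm hs0 hsTop, ENNReal.toReal_ofReal (by positivity)]
      congr 1
      refine integral_congr_ae (Filter.Eventually.of_forall fun t => ?_)
      simp only
      rw [habs, ← Real.rpow_mul (abs_nonneg _)]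
      congr 1
      exact hr.symm.sub_one_mul_conj
    have hIpos : 0 < I := by
      refine hI0.lt_of_ne fun h0 => ?_
      rw [hN, ← h0, Real.zero_rpow (inv_ne_zero hr.symm.ne_zero)] at hc
      linarith
    refine ⟨fun t => (I ^ v⁻¹)⁻¹ * (|K t| ^ (r - 1) * unitSign (K t)),
      fun t => by simp only [hK.1 t], hmem.const_mul _, ?_, ?_⟩
    · rw [normL_const_mul, hΦ0, abs_of_pos (by positivity), inv_mul_cancel₀ (by positivity)]
    · have e : ∀ t, (I ^ v⁻¹)⁻¹ * (|K t| ^ (r - 1) * unitSign (K t)) * K t =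
          (I ^ v⁻¹)⁻¹ * |K t| ^ r := by
        intro t
        rw [mul_assoc, mul_assoc, unitSign_mul_self]
        congr 1
        rw [← Real.rpow_add_one' (abs_nonneg _) (by linarith [hr.symm.pos])]
        congr 1; ring
      simp_rw [e]
      rw [integral_const_mul, ← hI]
      refine hc.le.trans (le_of_eq ?_)
      rw [hN, ← Real.rpow_neg hI0]
      nth_rw 3 [← Real.rpow_one I]
      rw [← Real.rpow_add hIpos]
      congr 1
      have := hr.inv_add_inv_eq_one
      linarith

/-! ### Norms of rapidly oscillating functions by averaging over the phase -/

lemma memC_cos : MemC Real.cos := ⟨Real.cos_periodic, Real.continuous_cos⟩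

lemma re_exp_mul_eq_norm_mul_cos (y : ℝ) (z : ℂ) :
    (Complex.exp (y * Complex.I) * z).re = ‖z‖ * Real.cos (y + z.arg) := by
  conv_lhs => rw [← Complex.norm_mul_exp_arg_mul_I z]
  rw [mul_left_comm, ← Complex.exp_add, ← add_mul, ← Complex.ofReal_add, Complex.re_ofReal_mul,
    Complex.exp_ofReal_mul_I_re]

lemma norm_exp_mul_re_le (y : ℝ) (z : ℂ) : ‖(Complex.exp (y * Complex.I) * z).re‖ ≤ ‖z‖ := by
  refine (Complex.abs_re_le_norm _).trans ?_
  rw [norm_mul, Complex.norm_exp_ofReal_mul_I, one_mul]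

lemma eLpNorm_cos_top : eLpNorm Real.cos ⊤ periodMeasure = 1 := by
  apply le_antisymm
  · have := eLpNorm_le_of_ae_bound (p := ⊤) (μ := periodMeasure) (f := Real.cos) (C := 1)
      (Filter.Eventually.of_forall fun t => Real.abs_cos_le_one t)
    simpa using this
  · simpa using enorm_le_eLpNorm_top memC_cos.1 memC_cos.2 0

/-- The argument of `z` and the offset `y` only translate the cosine, so its integral over a full
period of phases depends on `‖z‖` alone. -/
lemma lintegral_enorm_re_exp_mul (r : ℝ) (hr : 0 < r) (y : ℝ) (z : ℂ) :
    ∫⁻ θ, ‖(Complex.exp (((y + θ : ℝ) : ℂ) * Complex.I) * z).re‖ₑ ^ r ∂periodMeasure =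
      ‖z‖ₑ ^ r * eLpNorm Real.cos (ENNReal.ofReal r) periodMeasure ^ r := by
  have h1 : eLpNorm (fun θ : ℝ => Real.cos (θ + (y + z.arg))) (ENNReal.ofReal r) periodMeasure ^ r
      = ∫⁻ θ, ‖Real.cos (θ + (y + z.arg))‖ₑ ^ r ∂periodMeasure := by
    rw [eLpNorm_eq_lintegral_rpow_enorm_toReal (by simpa using hr) ENNReal.ofReal_ne_top,
      ENNReal.toReal_ofReal hr.le, one_div, ENNReal.rpow_inv_rpow hr.ne']
  rw [eLpNorm_comp_add_right memC_cos.1 memC_cos.2] at h1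
  rw [h1, ← lintegral_const_mul _ (by fun_prop)]
  refine lintegral_congr fun θ => ?_
  rw [re_exp_mul_eq_norm_mul_cos, enorm_mul, enorm_norm, ENNReal.mul_rpow_of_nonneg _ _ hr.le]
  congr 4
  ring

section Oscillation

variable {h : ℝ → ℂ} (hp : Function.Periodic h (2 * Real.pi)) (hc : Continuous h)
  (m : ℕ) (b : ℝ)

/-- `h` modulated by a frequency `m` with the phase shifted by `θ`. -/
noncomputable def modulated (h : ℝ → ℂ) (m : ℕ) (b θ t : ℝ) : ℝ :=
  (Complex.exp (((m * t - b + θ : ℝ) : ℂ) * Complex.I) * h t).re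

include hc in
lemma continuous_modulated (θ : ℝ) : Continuous (modulated h m b θ) := by
  unfold modulated; fun_prop

include hp in
lemma periodic_modulated (θ : ℝ) : Function.Periodic (modulated h m b θ) (2 * Real.pi) := by
  intro t
  unfold modulated
  rw [hp t]
  congr 2
  have : ((m * (t + 2 * Real.pi) - b + θ : ℝ) : ℂ) * Complex.I =
      ((m * t - b + θ : ℝ) : ℂ) * Complex.I + (m : ℤ) * (2 * Real.pi * Complex.I) := by
    push_cast; ring
  rw [this]
  exact Complex.exp_periodic.int_mul m _

include hp hc in
-- Translation by `θ / m` advances the carrier phase by exactly `θ` and preserves the norm; what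
-- differs from `modulated h m b θ` is only `h (t + θ / m)` in place of `h t`.
lemma modulated_close {u : ENNReal} (hu : 1 ≤ u) (hm : 1 ≤ m) {D : ENNReal} (θ : ℝ)
    (hD : eLpNorm (fun t => h (t + θ / m) - h t) u periodMeasure ≤ D) :
    eLpNorm (modulated h m b 0) u periodMeasure ≤ eLpNorm (modulated h m b θ) u periodMeasure + D ∧
    eLpNorm (modulated h m b θ) u periodMeasure ≤
      eLpNorm (modulated h m b 0) u periodMeasure + D := by
  have hmR : (m : ℝ) ≠ 0 := by positivity
  have hc0 := continuous_modulated hc m b 0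
  have hcθ := continuous_modulated hc m b θ
  have hsh := eLpNorm_comp_add_right (periodic_modulated hp m b 0) hc0 u (θ / m)
  have hcs : Continuous fun t => modulated h m b 0 (t + θ / m) := hc0.comp (by fun_prop)
  have hdiff : eLpNorm ((fun t => modulated h m b 0 (t + θ / m)) - modulated h m b θ) u
      periodMeasure ≤ D := by
    refine (eLpNorm_mono fun t => ?_).trans hD
    have e : ((m * (t + θ / m) - b + 0 : ℝ) : ℂ) = ((m * t - b + θ : ℝ) : ℂ) := by
      congr 1; field_simp; ring
    rw [Pi.sub_apply, modulated, modulated, e, ← Complex.sub_re, ← mul_sub]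
    exact norm_exp_mul_re_le _ _
  constructor
  · rw [← hsh]
    calc _ = eLpNorm (modulated h m b θ + ((fun t => modulated h m b 0 (t + θ / m)) -
          modulated h m b θ)) u periodMeasure := by congr 1; abel
      _ ≤ _ := (eLpNorm_add_le hcθ.aestronglyMeasurable
          (hcs.sub hcθ).aestronglyMeasurable hu).trans (by gcongr)
  · rw [← hsh]
    calc _ = eLpNorm ((fun t => modulated h m b 0 (t + θ / m)) -
          ((fun t => modulated h m b 0 (t + θ / m)) - modulated h m b θ)) u periodMeasure := by
            congr 1; abel
      _ ≤ _ := (eLpNorm_sub_le hcs.aestronglyMeasurable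
          (hcs.sub hcθ).aestronglyMeasurable hu).trans (by gcongr)

include hp hc in
-- For finite `u`, Fubini shows that the mean over `θ` of the `u`-th power of the norm is the `u`-th
-- power of the product; a function takes values on both sides of its mean. For `u = ∞` every phase
-- satisfies the upper bound, and a suitable phase reaches the lower one.
lemma exists_phase {u : ENNReal} (hu : 1 ≤ u) :
    (∃ θ ∈ Set.Ioc 0 (2 * Real.pi), eLpNorm (modulated h m b θ) u periodMeasure ≤
      ENNReal.ofReal (2 * Real.pi) ^ (-(u⁻¹).toReal) * eLpNorm Real.cos u periodMeasure *
        eLpNorm h u periodMeasure) ∧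
    ∃ θ ∈ Set.Ioc 0 (2 * Real.pi), ENNReal.ofReal (2 * Real.pi) ^ (-(u⁻¹).toReal) *
      eLpNorm Real.cos u periodMeasure * eLpNorm h u periodMeasure ≤
        eLpNorm (modulated h m b θ) u periodMeasure := by
  rcases eq_or_ne u ⊤ with rfl | huTop
  · simp only [ENNReal.inv_top, ENNReal.toReal_zero, neg_zero, ENNReal.rpow_zero, one_mul,
      eLpNorm_cos_top]
    constructor
    · exact ⟨2 * Real.pi, ⟨Real.two_pi_pos, le_rfl⟩, eLpNorm_mono fun t => norm_exp_mul_re_le _ _⟩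
    · obtain ⟨x₀, hx₀⟩ := exists_forall_norm_le hp hc
      -- This phase aligns the carrier with the argument of `h` at a maximum point of `‖h‖`, so the
      -- real part there is the full modulus.
      refine ⟨toIocMod Real.two_pi_pos 0 (-(m * x₀ - b + (h x₀).arg)),
        by simpa using toIocMod_mem_Ioc Real.two_pi_pos 0 _, ?_⟩
      set θ := toIocMod Real.two_pi_pos 0 (-(m * x₀ - b + (h x₀).arg)) with hθ
      have h1 := enorm_le_eLpNorm_top (periodic_modulated hp m b θ)
        (continuous_modulated hc m b θ) x₀
      refine le_trans ?_ h1
      have h2 : modulated h m b θ x₀ = ‖h x₀‖ := by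
        rw [modulated, re_exp_mul_eq_norm_mul_cos]
        have : Real.cos (m * x₀ - b + θ + (h x₀).arg) = 1 := by
          have e := toIocMod_add_toIocDiv_zsmul Real.two_pi_pos 0 (-(m * x₀ - b + (h x₀).arg))
          rw [← hθ, zsmul_eq_mul] at e
          rw [show m * x₀ - b + θ + (h x₀).arg =
            ((-(toIocDiv Real.two_pi_pos 0 (-(m * x₀ - b + (h x₀).arg))) : ℤ) : ℝ) *
              (2 * Real.pi) by push_cast; linarith]
          exact Real.cos_int_mul_two_pi _
        rw [this, mul_one]
      rw [h2, enorm_norm, ← ofReal_norm]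
      have h3 := eLpNorm_le_of_ae_bound (p := ⊤) (μ := periodMeasure)
        (Filter.Eventually.of_forall hx₀)
      simpa using h3
  · have hu0 : u ≠ 0 := (zero_lt_one.trans_le hu).ne'
    set r := u.toReal with hr
    have hr0 : 0 < r := ENNReal.toReal_pos hu0 huTop
    have hur : ENNReal.ofReal r = u := ENNReal.ofReal_toReal huTop
    have hpow : ∀ θ, eLpNorm (modulated h m b θ) u periodMeasure ^ r =
        ∫⁻ t, ‖modulated h m b θ t‖ₑ ^ r ∂periodMeasure := fun θ => by
      rw [eLpNorm_eq_lintegral_rpow_enorm_toReal hu0 huTop, one_div, ENNReal.rpow_inv_rpow hr0.ne']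
    have hpowh : eLpNorm h u periodMeasure ^ r = ∫⁻ t, ‖h t‖ₑ ^ r ∂periodMeasure := by
      rw [eLpNorm_eq_lintegral_rpow_enorm_toReal hu0 huTop, one_div, ENNReal.rpow_inv_rpow hr0.ne']
    have hmeas : Measurable fun x : ℝ × ℝ => ‖modulated h m b x.1 x.2‖ₑ ^ r := by
      have : Continuous fun x : ℝ × ℝ => modulated h m b x.1 x.2 := by
        unfold modulated; fun_prop
      exact this.measurable.enorm.pow_const _
    have hav : ⨍⁻ θ, eLpNorm (modulated h m b θ) u periodMeasure ^ r ∂periodMeasure =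
        (ENNReal.ofReal (2 * Real.pi) ^ (-(u⁻¹).toReal) * eLpNorm Real.cos u periodMeasure *
          eLpNorm h u periodMeasure) ^ r := by
      rw [laverage_eq, periodMeasure_univ]
      simp_rw [hpow]
      rw [lintegral_lintegral_swap hmeas.aemeasurable]
      simp_rw [modulated]
      simp_rw [lintegral_enorm_re_exp_mul r hr0]
      rw [lintegral_mul_const _ (by fun_prop), ← hpowh, hur,
        ENNReal.mul_rpow_of_nonneg _ _ hr0.le, ENNReal.mul_rpow_of_nonneg _ _ hr0.le,
        ← ENNReal.rpow_mul, ENNReal.toReal_inv, neg_mul, ← hr, inv_mul_cancel₀ hr0.ne',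
        ENNReal.rpow_neg_one, div_eq_mul_inv]
      ring
    have hmeasN : AEMeasurable (fun θ => eLpNorm (modulated h m b θ) u periodMeasure ^ r)
        periodMeasure := by
      simp_rw [hpow]
      exact (Measurable.lintegral_prod_right' hmeas).aemeasurable
    have hfin : eLpNorm h u periodMeasure < ⊤ := (memLp_of_continuous_periodic hp hc u).2
    have hI : volume (Set.Ioc 0 (2 * Real.pi)) ≠ 0 := by
      simp [Real.pi_pos]
    constructor
    · obtain ⟨θ, hθ, hle⟩ := exists_le_setLAverage hI measure_Ioc_lt_top.ne hmeasN
      refine ⟨θ, hθ, ?_⟩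
      change _ ≤ ⨍⁻ θ, _ ∂periodMeasure at hle
      rw [hav] at hle
      exact (ENNReal.rpow_le_rpow_iff hr0).1 hle
    · obtain ⟨θ, hθ, hle⟩ := exists_setLAverage_le (μ := volume)
        (f := fun θ => eLpNorm (modulated h m b θ) u periodMeasure ^ r) hI
        measurableSet_Ioc.nullMeasurableSet (by
          refine ((lintegral_mono (g := fun _ => eLpNorm h u periodMeasure ^ r) fun θ => ?_).trans_lt
            ?_).ne
          · exact ENNReal.rpow_le_rpow (eLpNorm_mono fun t => norm_exp_mul_re_le _ _) hr0.le
          · rw [setLIntegral_const]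
            exact ENNReal.mul_lt_top (ENNReal.rpow_lt_top_of_nonneg hr0.le hfin.ne)
              measure_Ioc_lt_top)
      refine ⟨θ, hθ, ?_⟩
      change ⨍⁻ θ, _ ∂periodMeasure ≤ _ at hle
      rw [hav] at hle
      exact (ENNReal.rpow_le_rpow_iff hr0).1 hle

include hp hc in
/-- The norm of a modulated function is close to the product of the norms. -/
lemma abs_normL_modulated_sub_le {u : ENNReal} (hu : 1 ≤ u) (hm : 1 ≤ m) {D : ℝ} (hD0 : 0 ≤ D)
    (hD : ∀ θ ∈ Set.Ioc 0 (2 * Real.pi),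
      eLpNorm (fun t => h (t + θ / m) - h t) u periodMeasure ≤ ENNReal.ofReal D) :
    |normL u (modulated h m b 0) - (2 * Real.pi) ^ (-(u⁻¹).toReal) * normL u Real.cos *
      normL u (fun t => ‖h t‖)| ≤ D := by
  obtain ⟨⟨θ₁, hθ₁, h1⟩, θ₂, hθ₂, h2⟩ := exists_phase hp hc m b hu
  have h1' := (modulated_close hp hc m b hu hm θ₁ (hD θ₁ hθ₁)).1.trans (add_le_add_left h1 _)
  have h2' := h2.trans (modulated_close hp hc m b hu hm θ₂ (hD θ₂ hθ₂)).2
  have hGfin : eLpNorm (modulated h m b 0) u periodMeasure ≠ ⊤ :=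
    (memLp_of_continuous_periodic (periodic_modulated hp m b 0)
      (continuous_modulated hc m b 0) u).2.ne
  have hhfin : eLpNorm h u periodMeasure ≠ ⊤ := (memLp_of_continuous_periodic hp hc u).2.ne
  have hcfin : eLpNorm Real.cos u periodMeasure ≠ ⊤ :=
    (memLp_of_continuous_periodic memC_cos.1 memC_cos.2 u).2.ne
  have hpfin : ENNReal.ofReal (2 * Real.pi) ^ (-(u⁻¹).toReal) ≠ ⊤ := by
    rw [ENNReal.ofReal_rpow_of_pos Real.two_pi_pos]; exact ENNReal.ofReal_ne_top
  have hprod : ENNReal.ofReal (2 * Real.pi) ^ (-(u⁻¹).toReal) * eLpNorm Real.cos u periodMeasure *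
        eLpNorm h u periodMeasure ≠ ⊤ := ENNReal.mul_ne_top (ENNReal.mul_ne_top hpfin hcfin) hhfin
  have hval : (ENNReal.ofReal (2 * Real.pi) ^ (-(u⁻¹).toReal) *
      eLpNorm Real.cos u periodMeasure * eLpNorm h u periodMeasure).toReal =
      (2 * Real.pi) ^ (-(u⁻¹).toReal) * normL u Real.cos * normL u (fun t => ‖h t‖) := by
    rw [ENNReal.toReal_mul, ENNReal.toReal_mul, ENNReal.ofReal_rpow_of_pos Real.two_pi_pos,
      ENNReal.toReal_ofReal (by positivity), normL, normL, eLpNorm_norm]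
  have r1 := ENNReal.toReal_mono (ENNReal.add_ne_top.2 ⟨hprod, ENNReal.ofReal_ne_top⟩) h1'
  have r2 := ENNReal.toReal_mono (ENNReal.add_ne_top.2 ⟨hGfin, ENNReal.ofReal_ne_top⟩) h2'
  rw [ENNReal.toReal_add hprod ENNReal.ofReal_ne_top, hval, ENNReal.toReal_ofReal hD0] at r1
  rw [ENNReal.toReal_add hGfin ENNReal.ofReal_ne_top, hval, ENNReal.toReal_ofReal hD0] at r2
  rw [abs_le]
  unfold normL at *
  constructor <;> linarith

end Oscillation

/-! ### The generating function on the circle of radius `q` and its modulus of continuity -/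

/-- The generating function `∑ min(p, j+1) z^j = (1 - z^p) / (1 - z)^2`. -/
noncomputable def vpGen (p : ℕ) (z : ℂ) : ℂ := (1 - z ^ p) / (1 - z) ^ 2

lemma one_sub_ne_zero_of_norm_lt {z : ℂ} (hz : ‖z‖ < 1) : 1 - z ≠ 0 := by
  intro h
  rw [← sub_eq_zero.1 h] at hz
  simp at hz

/-- The coefficient `min p (j+1)` counts the `i < p` with `i ≤ j`, so the series is a sum of `p`
geometric series, the `i`-th starting at `z ^ i`. -/
lemma hasSum_vpGen (p : ℕ) {z : ℂ} (hz : ‖z‖ < 1) :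
    HasSum (fun j : ℕ => ((min p (j + 1) : ℕ) : ℂ) * z ^ j) (vpGen p z) := by
  have h1 : ∀ i : ℕ, HasSum (fun j : ℕ => if i ≤ j then z ^ j else 0) (z ^ i / (1 - z)) := by
    intro i
    have h2 := (hasSum_geometric_of_norm_lt_one hz).mul_left (z ^ i)
    rw [← div_eq_mul_inv] at h2
    have h3 : Function.Injective fun j : ℕ => j + i := add_left_injective i
    rw [← h3.hasSum_iff (f := fun j : ℕ => if i ≤ j then z ^ j else 0)]
    · convert! h2 using 2 with j
      simp [pow_add, mul_comm]
    · intro j hj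
      refine if_neg fun hij => hj ⟨j - i, by simp; omega⟩
  have h4 := hasSum_sum (s := Finset.range p) (fun i _ => h1 i)
  have hne := one_sub_ne_zero_of_norm_lt hz
  convert! h4 using 1
  · funext j
    rw [← Finset.sum_filter, Finset.sum_const, nsmul_eq_mul]
    congr 2
    have : (Finset.range p).filter (· ≤ j) = Finset.range (min p (j + 1)) := by
      ext; simp only [Finset.mem_filter, Finset.mem_range]; omega
    rw [this, Finset.card_range]
  · rw [← Finset.sum_div, geom_sum_eq (fun h => hne (by rw [h, sub_self])), vpGen]
    have : z - 1 ≠ 0 := fun h => hne (by linear_combination -h)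
    field_simp
    ring

lemma circleMap_zero_eq (q t : ℝ) : circleMap 0 q t = q * Complex.exp (t * Complex.I) := by
  simp [circleMap]

lemma norm_circleMap_lt {q : ℝ} (h0 : 0 < q) (h1 : q < 1) (t : ℝ) : ‖circleMap 0 q t‖ < 1 := by
  rw [norm_circleMap_zero, abs_of_pos h0]; exact h1

lemma normSq_one_sub_circleMap_pow (q t : ℝ) (p : ℕ) :
    ‖1 - circleMap 0 q t ^ p‖ ^ 2 = 1 - 2 * q ^ p * Real.cos (p * t) + q ^ (2 * p) := by
  have : circleMap 0 q t ^ p = ((q ^ p : ℝ) : ℂ) * Complex.exp (((p * t : ℝ) : ℂ) * Complex.I) := by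
    rw [circleMap_zero_eq, mul_pow, ← Complex.exp_nat_mul]
    push_cast
    rw [mul_assoc]
  rw [this, ← Complex.normSq_eq_norm_sq, Complex.normSq_apply]
  simp only [Complex.sub_re, Complex.sub_im, Complex.one_re, Complex.one_im, Complex.re_ofReal_mul,
    Complex.im_ofReal_mul, Complex.exp_ofReal_mul_I_re, Complex.exp_ofReal_mul_I_im]
  have := Real.sin_sq_add_cos_sq (p * t)
  rw [pow_mul' q 2 p]
  linear_combination (q ^ p) ^ 2 * this

lemma norm_vpGen_circleMap (q t : ℝ) (p : ℕ) :
    ‖vpGen p (circleMap 0 q t)‖ = Real.sqrt (1 - 2 * q ^ p * Real.cos (p * t) + q ^ (2 * p)) /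
      (1 - 2 * q * Real.cos t + q ^ 2) := by
  have h1 := normSq_one_sub_circleMap_pow q t 1
  simp only [pow_one, Nat.cast_one, one_mul, mul_one] at h1
  rw [vpGen, norm_div, norm_pow, h1, ← normSq_one_sub_circleMap_pow, Real.sqrt_sq (norm_nonneg _)]

section

variable {q : ℝ} (h0 : 0 < q) (h1 : q < 1)

include h0 h1 in
lemma continuous_vpGen_circleMap (p : ℕ) : Continuous fun t => vpGen p (circleMap 0 q t) := by
  unfold vpGen
  refine Continuous.div (by fun_prop) (by fun_prop) fun t => ?_
  exact pow_ne_zero _ (one_sub_ne_zero_of_norm_lt (norm_circleMap_lt h0 h1 t))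

lemma periodic_vpGen_circleMap (q : ℝ) (p : ℕ) :
    Function.Periodic (fun t => vpGen p (circleMap 0 q t)) (2 * Real.pi) := fun t => by
  simp only [periodic_circleMap 0 q t]

lemma norm_exp_sub_exp_le (x y : ℝ) :
    ‖Complex.exp (x * Complex.I) - Complex.exp (y * Complex.I)‖ ≤ |x - y| := by
  have e : Complex.exp (x * Complex.I) - Complex.exp (y * Complex.I) =
      Complex.exp (y * Complex.I) * (Complex.exp (Complex.I * ((x - y : ℝ) : ℂ)) - 1) := by
    rw [mul_sub, ← Complex.exp_add, mul_one]
    congr 2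
    push_cast; ring
  rw [e, norm_mul, Complex.norm_exp_ofReal_mul_I, one_mul]
  exact Real.norm_exp_I_mul_ofReal_sub_one_le

include h0 in
lemma norm_circleMap_pow_sub_le (j : ℕ) (x y : ℝ) :
    ‖circleMap 0 q x ^ j - circleMap 0 q y ^ j‖ ≤ j * q ^ j * |x - y| := by
  rw [circleMap_zero_eq, circleMap_zero_eq, mul_pow, mul_pow, ← mul_sub, norm_mul, norm_pow,
    Complex.norm_real, Real.norm_of_nonneg h0.le, ← Complex.exp_nat_mul, ← Complex.exp_nat_mul]
  have := norm_exp_sub_exp_le (j * x) (j * y)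
  rw [← mul_sub, abs_mul, Nat.abs_cast] at this
  push_cast at this
  rw [mul_assoc, mul_assoc] at this
  calc _ ≤ q ^ j * (j * |x - y|) := by gcongr
    _ = _ := by ring

include h0 h1 in
lemma norm_vpGen_sub_le_of_hasSum (p : ℕ) {L : ℝ}
    (hL : HasSum (fun j : ℕ => ((min p (j + 1) : ℕ) : ℝ) * (j * q ^ j)) L) (x y : ℝ) :
    ‖vpGen p (circleMap 0 q x) - vpGen p (circleMap 0 q y)‖ ≤ L * |x - y| := by
  have hx := hasSum_vpGen p (norm_circleMap_lt h0 h1 x)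
  have hy := hasSum_vpGen p (norm_circleMap_lt h0 h1 y)
  rw [← (hx.sub hy).tsum_eq]
  refine tsum_of_norm_bounded (hL.mul_right |x - y|) fun j => ?_
  rw [← mul_sub, norm_mul, Complex.norm_natCast, mul_assoc]
  have := norm_circleMap_pow_sub_le h0 j x y
  gcongr

include h0 h1 in
-- After dropping the zero term this is `2q ∑ choose (j+2) 2 q^j`.
lemma hasSum_mul_succ_geometric :
    HasSum (fun j : ℕ => ((j + 1 : ℕ) : ℝ) * (j * q ^ j)) (2 * q / (1 - q) ^ 3) := by
  have hq : ‖q‖ < 1 := by rwa [Real.norm_of_nonneg h0.le]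
  have h := (hasSum_choose_mul_geometric_of_norm_lt_one 2 hq).mul_left (2 * q)
  rw [← hasSum_nat_add_iff' 1]
  simp only [Finset.range_one, Finset.sum_singleton, Nat.cast_zero, zero_mul, mul_zero, sub_zero]
  convert! h using 1
  · funext j
    have : ((j + 2).choose 2 : ℝ) = (j + 2) * (j + 1) / 2 := by
      rw [Nat.cast_choose_two]; push_cast; ring
    rw [this]
    push_cast
    ring
  · rw [mul_one_div]

include h0 h1 in
-- Bounding the weight by `j + 1` makes the Lipschitz constant independent of `p`, at the price of
-- the exponent `3`. For `p = 1` the weight is `1` and the exponent drops to `2`.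
lemma norm_vpGen_sub_le (p : ℕ) (x y : ℝ) :
    ‖vpGen p (circleMap 0 q x) - vpGen p (circleMap 0 q y)‖ ≤ 2 * q / (1 - q) ^ 3 * |x - y| := by
  have hS := hasSum_mul_succ_geometric h0 h1
  have hle : ∀ j : ℕ, ((min p (j + 1) : ℕ) : ℝ) * (j * q ^ j) ≤ ((j + 1 : ℕ) : ℝ) * (j * q ^ j) :=
    fun j => by gcongr; exact min_le_right _ _
  have hs : Summable fun j : ℕ => ((min p (j + 1) : ℕ) : ℝ) * (j * q ^ j) :=
    Summable.of_nonneg_of_le (fun j => by positivity) hle hS.summable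
  refine (norm_vpGen_sub_le_of_hasSum h0 h1 p hs.hasSum x y).trans ?_
  gcongr
  exact hasSum_le hle hs.hasSum hS

include h0 h1 in
lemma norm_vpGen_one_sub_le (x y : ℝ) :
    ‖vpGen 1 (circleMap 0 q x) - vpGen 1 (circleMap 0 q y)‖ ≤ q / (1 - q) ^ 2 * |x - y| := by
  refine norm_vpGen_sub_le_of_hasSum h0 h1 1 ?_ x y
  have hq : ‖q‖ < 1 := by rwa [Real.norm_of_nonneg h0.le]
  simpa using hasSum_coe_mul_geometric_of_norm_lt_one hq

lemma vpGen_one (z : ℂ) : vpGen 1 z = (1 - z)⁻¹ := by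
  rw [vpGen, pow_one, pow_two]
  rcases eq_or_ne (1 - z) 0 with h | h
  · simp [h]
  · field_simp

include h0 h1 in
lemma integral_circleMap_of_differentiable {f : ℂ → ℂ}
    (hf : ∀ z : ℂ, ‖z‖ < 1 → DifferentiableAt ℂ f z) :
    ∫ t, f (circleMap 0 q t) ∂periodMeasure = 2 * Real.pi * f 0 := by
  have hd : DiffContOnCl ℂ f (Metric.ball 0 |q|) := by
    refine DifferentiableOn.diffContOnCl fun z hz => (hf z ?_).differentiableWithinAt
    have := Metric.closure_ball_subset_closedBall hz
    rw [mem_closedBall_zero_iff, abs_of_pos h0] at this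
    exact this.trans_lt h1
  have h := hd.circleAverage
  rw [Real.circleAverage_def, intervalIntegral_eq_integral_periodMeasure] at h
  rw [← h, Complex.real_smul]
  have : (Real.pi : ℂ) ≠ 0 := by exact_mod_cast Real.pi_ne_zero
  push_cast
  field_simp

include h0 h1 in
-- On the circle `|1 - z|⁻²` is, up to the factor `1 - q²`, the Poisson kernel `Re ((1+z)/(1-z))`,
-- whose mean is its value `1` at the origin.
lemma integral_norm_vpGen_one_sq :
    ∫ t, ‖vpGen 1 (circleMap 0 q t)‖ ^ 2 ∂periodMeasure = 2 * Real.pi / (1 - q ^ 2) := by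
  have hI := integral_circleMap_of_differentiable h0 h1 (f := fun z => (1 + z) / (1 - z))
    (fun z hz => DifferentiableAt.div (by fun_prop) (by fun_prop) (one_sub_ne_zero_of_norm_lt hz))
  have hq2 : (1 : ℝ) - q ^ 2 ≠ 0 := by nlinarith
  have e : ∀ t, ‖vpGen 1 (circleMap 0 q t)‖ ^ 2 =
      (1 - q ^ 2)⁻¹ * ((1 + circleMap 0 q t) / (1 - circleMap 0 q t)).re := by
    intro t
    have hz := one_sub_ne_zero_of_norm_lt (norm_circleMap_lt h0 h1 t)
    have hn : Complex.normSq (circleMap 0 q t) = q ^ 2 := by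
      rw [Complex.normSq_eq_norm_sq, norm_circleMap_zero, sq_abs]
    set z := circleMap 0 q t
    have hz2 : Complex.normSq (1 - z) ≠ 0 := by simpa using hz
    rw [vpGen_one, norm_inv, inv_pow, ← Complex.normSq_eq_norm_sq, Complex.div_re,
      eq_inv_mul_iff_mul_eq₀ hq2, ← hn]
    rw [← add_div, ← div_eq_mul_inv]
    congr 1
    simp [Complex.normSq_apply]
    ring
  have hint : Integrable (fun t => (1 + circleMap 0 q t) / (1 - circleMap 0 q t)) periodMeasure := by
    refine memLp_one_iff_integrable.1 (memLp_of_continuous_periodic (fun t => ?_) ?_ 1)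
    · simp only [periodic_circleMap 0 q t]
    · exact Continuous.div (by fun_prop) (by fun_prop)
        fun t => one_sub_ne_zero_of_norm_lt (norm_circleMap_lt h0 h1 t)
  simp_rw [e]
  rw [integral_const_mul]
  have h3 := integral_re hint
  simp only [RCLike.re_to_complex] at h3
  rw [h3, hI, inv_mul_eq_div]
  simp

include h0 h1 in
-- The difference of two values of `1/(1-z)` is the increment of `z` times the product of these
-- values. By the arithmetic-geometric mean inequality the product integrates like `|1 - z|⁻²`,
-- which costs a single power of `1 - q`; hence `sigmaExp 1 1 = 1`.
lemma eLpNorm_one_vpGen_one_sub_le (x : ℝ) :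
    eLpNorm (fun t => vpGen 1 (circleMap 0 q (t + x)) - vpGen 1 (circleMap 0 q t)) 1 periodMeasure ≤
      ENNReal.ofReal (2 * Real.pi * q / (1 - q) * |x|) := by
  set g : ℝ → ℂ := fun t => vpGen 1 (circleMap 0 q t) with hg
  have hgc : Continuous g := continuous_vpGen_circleMap h0 h1 1
  have hgp : Function.Periodic g (2 * Real.pi) := periodic_vpGen_circleMap q 1
  have hg2 : MemC fun t => ‖g t‖ ^ 2 := ⟨fun t => by simp only [hgp t], by fun_prop⟩
  have hg2x : MemC fun t => ‖g (t + x)‖ ^ 2 :=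
    ⟨fun t => by
      simp only
      rw [← hgp (t + x)]
      ring_nf, by fun_prop⟩
  have hshift : ∫ t, ‖g (t + x)‖ ^ 2 ∂periodMeasure = ∫ t, ‖g t‖ ^ 2 ∂periodMeasure := by
    have := eLpNorm_comp_add_right hg2.1 hg2.2 1 x
    rw [eLpNorm_one_eq_lintegral_enorm, eLpNorm_one_eq_lintegral_enorm] at this
    have h3 := congrArg ENNReal.toReal this
    rw [← integral_norm_eq_lintegral_enorm hg2x.2.aestronglyMeasurable,
      ← integral_norm_eq_lintegral_enorm hg2.2.aestronglyMeasurable] at h3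
    simpa using h3
  have hpt : ∀ t, ‖g (t + x) - g t‖ ≤ q * |x| / 2 * (‖g (t + x)‖ ^ 2 + ‖g t‖ ^ 2) := by
    intro t
    have hz := one_sub_ne_zero_of_norm_lt (norm_circleMap_lt h0 h1 t)
    have hz' := one_sub_ne_zero_of_norm_lt (norm_circleMap_lt h0 h1 (t + x))
    have e : g (t + x) - g t = (circleMap 0 q (t + x) - circleMap 0 q t) *
        (g (t + x) * g t) := by
      simp only [hg, vpGen_one]
      field_simp
      ring
    rw [e, norm_mul, norm_mul]
    have h3 : ‖circleMap 0 q (t + x) - circleMap 0 q t‖ ≤ q * |x| := by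
      simpa using norm_circleMap_pow_sub_le h0 1 (t + x) t
    calc _ ≤ q * |x| * (‖g (t + x)‖ * ‖g t‖) := by gcongr
      _ ≤ q * |x| * ((‖g (t + x)‖ ^ 2 + ‖g t‖ ^ 2) / 2) := by
          gcongr
          nlinarith [sq_nonneg (‖g (t + x)‖ - ‖g t‖)]
      _ = _ := by ring
  have hmeas : AEStronglyMeasurable (fun t => g (t + x) - g t) periodMeasure :=
    ((hgc.comp (by fun_prop)).sub hgc).aestronglyMeasurable
  have hgi : MemLp (fun t => g (t + x) - g t) 1 periodMeasure :=
    memLp_of_continuous_periodic (fun t => by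
      have : g (t + 2 * Real.pi + x) = g (t + x) := by rw [← hgp (t + x)]; ring_nf
      change g (t + 2 * Real.pi + x) - g (t + 2 * Real.pi) = g (t + x) - g t
      rw [this, hgp t]) ((hgc.comp (by fun_prop)).sub hgc) 1
  change eLpNorm (fun t => g (t + x) - g t) 1 periodMeasure ≤ _
  rw [← ENNReal.ofReal_toReal hgi.2.ne]
  refine ENNReal.ofReal_le_ofReal ?_
  rw [eLpNorm_one_eq_lintegral_enorm, ← integral_norm_eq_lintegral_enorm hmeas]
  have hq1 : 0 < 1 - q := by linarith
  calc ∫ t, ‖g (t + x) - g t‖ ∂periodMeasure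
      ≤ ∫ t, q * |x| / 2 * (‖g (t + x)‖ ^ 2 + ‖g t‖ ^ 2) ∂periodMeasure :=
        integral_mono (memLp_one_iff_integrable.1 hgi).norm
          ((hg2x.integrable.add hg2.integrable).const_mul _) hpt
    _ = q * |x| * (2 * Real.pi / (1 - q ^ 2)) := by
        rw [integral_const_mul, integral_add hg2x.integrable hg2.integrable, hshift,
          integral_norm_vpGen_one_sq h0 h1]
        ring
    _ ≤ q * |x| * (2 * Real.pi / (1 - q)) := by
        gcongr
        nlinarith
    _ = _ := by ring

include h0 h1 in
lemma eLpNorm_vpGen_sub_le {u : ENNReal} (hu : 1 ≤ u) {p m : ℕ} (hm : 1 ≤ m) {θ : ℝ}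
    (hθ : θ ∈ Set.Ioc 0 (2 * Real.pi)) :
    eLpNorm (fun t => vpGen p (circleMap 0 q (t + θ / m)) - vpGen p (circleMap 0 q t)) u
      periodMeasure ≤
        ENNReal.ofReal (8 * Real.pi ^ 2 * (q / (m * (1 - q) ^ sigmaExp u p))) := by
  have hm0 : (0 : ℝ) < m := by positivity
  have hq1 : 0 < 1 - q := by linarith
  have habs : |θ / m| ≤ 2 * Real.pi / m := by
    rw [abs_of_pos (div_pos hθ.1 hm0)]
    gcongr
    exact hθ.2
  have key : (∀ x y : ℝ, ‖vpGen p (circleMap 0 q x) - vpGen p (circleMap 0 q y)‖ ≤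
      2 * q / (1 - q) ^ sigmaExp u p * |x - y|) → eLpNorm (fun t =>
        vpGen p (circleMap 0 q (t + θ / m)) - vpGen p (circleMap 0 q t)) u periodMeasure ≤
        ENNReal.ofReal (8 * Real.pi ^ 2 * (q / (m * (1 - q) ^ sigmaExp u p))) := by
    intro hL
    -- The constant `8π²` is `2π` from passing to the uniform norm, `2` from the Lipschitz constant
    -- and `2π` from the range of `θ`.
    refine (eLpNorm_le_two_pi_mul hu (D := 2 * q / (1 - q) ^ sigmaExp u p * (2 * Real.pi / m))
      fun t => ?_).trans (ENNReal.ofReal_le_ofReal (le_of_eq (by field_simp; ring)))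
    refine (hL _ _).trans ?_
    rw [add_sub_cancel_left]
    gcongr
  by_cases hp : p = 1
  · subst hp
    by_cases hu1 : u = 1
    · subst hu1
      refine (eLpNorm_one_vpGen_one_sub_le h0 h1 _).trans (ENNReal.ofReal_le_ofReal ?_)
      have : sigmaExp 1 1 = 1 := by simp [sigmaExp]
      rw [this, pow_one]
      calc _ ≤ 2 * Real.pi * q / (1 - q) * (2 * Real.pi / m) := by gcongr
        _ = 4 * Real.pi ^ 2 * (q / (m * (1 - q))) := by field_simp; ring
        _ ≤ _ := by gcongr; norm_num
    · refine key fun x y => (norm_vpGen_one_sub_le h0 h1 x y).trans ?_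
      have : sigmaExp u 1 = 2 := by simp [sigmaExp, hu1]
      rw [this]
      gcongr
      linarith
  · refine key fun x y => ?_
    have : sigmaExp u p = 3 := by simp [sigmaExp, hp]
    rw [this]
    exact norm_vpGen_sub_le h0 h1 p x y

lemma normL_two_sq {f : ℝ → ℝ} (hf : MemC f) : normL 2 f ^ 2 = ∫ t, f t ^ 2 ∂periodMeasure := by
  have h := (memLp_of_continuous_periodic hf.1 hf.2 2).eLpNorm_eq_integral_rpow_norm
    two_ne_zero ENNReal.ofNat_ne_top
  have hI : 0 ≤ ∫ t, ‖f t‖ ^ (2 : ENNReal).toReal ∂periodMeasure :=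
    integral_nonneg fun t => by positivity
  rw [normL, h, ENNReal.toReal_ofReal (by positivity)]
  simp only [ENNReal.toReal_ofNat, Real.rpow_ofNat, Real.norm_eq_abs, sq_abs] at hI ⊢
  rw [← Real.rpow_natCast, ← Real.rpow_mul hI]
  norm_num

include h0 h1 in
/-- For the exponent `2` the modulated norm is exact. -/
lemma normL_two_modulated (p : ℕ) {m : ℕ} (hm : 1 ≤ m) (b : ℝ) :
    normL 2 (modulated (fun t => vpGen p (circleMap 0 q t)) m b 0) =
      (2 * Real.pi) ^ (-((2 : ENNReal)⁻¹).toReal) * normL 2 Real.cos *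
        normL 2 (fun t => ‖vpGen p (circleMap 0 q t)‖) := by
  set g : ℝ → ℂ := fun t => vpGen p (circleMap 0 q t) with hg
  have hgc : Continuous g := continuous_vpGen_circleMap h0 h1 p
  have hgp : Function.Periodic g (2 * Real.pi) := periodic_vpGen_circleMap q p
  have hG : MemC (modulated g m b 0) := ⟨periodic_modulated hgp m b 0, continuous_modulated hgc m b 0⟩
  have hn : MemC fun t => ‖g t‖ := ⟨fun t => by simp only [hgp t], hgc.norm⟩
  have hn2 : MemC fun t => ‖g t‖ ^ 2 := ⟨fun t => by simp only [hgp t], by fun_prop⟩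
  have hcos : normL 2 Real.cos ^ 2 = Real.pi := by
    rw [normL_two_sq memC_cos]
    have := integral_cos_mul_cos 1 1
    simp only [Nat.cast_one, one_mul] at this
    simp_rw [pow_two]
    simpa using this
  have hq0 : (q : ℂ) ≠ 0 := by exact_mod_cast h0.ne'
  -- `c` is chosen so that `c z^{2m} = e^{2i(mt-b)}` on the circle. Then `(Re w)² = (|w|² + Re
  -- w²)/2` splits the square into `|g|²/2` and half the real part of a function holomorphic in `z`.
  set c : ℂ := Complex.exp (-(2 * b) * Complex.I) * ((q : ℂ) ^ (2 * m))⁻¹ with hc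
  have hsq : ∀ t, modulated g m b 0 t ^ 2 =
      (1 / 2) * ‖g t‖ ^ 2 + (1 / 2) * (c * (circleMap 0 q t ^ (2 * m) * g t ^ 2)).re := by
    intro t
    have e : c * (circleMap 0 q t ^ (2 * m) * g t ^ 2) =
        (Complex.exp (((m * t - b + 0 : ℝ) : ℂ) * Complex.I) * g t) ^ 2 := by
      rw [hc, circleMap_zero_eq, mul_pow, mul_pow, ← Complex.exp_nat_mul, ← Complex.exp_nat_mul]
      have e2 : Complex.exp ((2 : ℕ) * (((m * t - b + 0 : ℝ) : ℂ) * Complex.I)) =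
          Complex.exp (-(2 * b) * Complex.I) *
            Complex.exp ((2 * m : ℕ) * ((t : ℂ) * Complex.I)) := by
        rw [← Complex.exp_add]
        congr 1
        push_cast; ring
      rw [e2]
      field_simp
    have hnorm : ‖g t‖ = ‖Complex.exp (((m * t - b + 0 : ℝ) : ℂ) * Complex.I) * g t‖ := by
      rw [norm_mul, Complex.norm_exp_ofReal_mul_I, one_mul]
    rw [e, hnorm, modulated, ← Complex.normSq_eq_norm_sq, Complex.normSq_apply, pow_two
      (Complex.exp _ * _), Complex.mul_re (Complex.exp _ * _)]
    ring
  have hint0 : ∫ t, c * (circleMap 0 q t ^ (2 * m) * g t ^ 2) ∂periodMeasure = 0 := by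
    rw [integral_const_mul]
    have := integral_circleMap_of_differentiable h0 h1
      (f := fun z => z ^ (2 * m) * vpGen p z ^ 2) (fun z hz => by
        have hd : DifferentiableAt ℂ (vpGen p) z := DifferentiableAt.div (by fun_prop)
          (by fun_prop) (pow_ne_zero _ (one_sub_ne_zero_of_norm_lt hz))
        fun_prop)
    rw [show (∫ t, circleMap 0 q t ^ (2 * m) * g t ^ 2 ∂periodMeasure) = _ from this]
    -- The mean value is the value at `0`, where `z ^ (2 * m)` vanishes because `m ≥ 1`.
    simp [show m ≠ 0 by omega]
  have hintg : Integrable (fun t => c * (circleMap 0 q t ^ (2 * m) * g t ^ 2)) periodMeasure :=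
    memLp_one_iff_integrable.1 (memLp_of_continuous_periodic
      (fun t => by simp only [hgp t, periodic_circleMap 0 q t]) (by fun_prop) 1)
  have h3 := integral_re hintg
  simp only [RCLike.re_to_complex] at h3
  have hintr : Integrable (fun t => (c * (circleMap 0 q t ^ (2 * m) * g t ^ 2)).re) periodMeasure :=
    hintg.re
  have hmain : normL 2 (modulated g m b 0) ^ 2 = (1 / 2) * normL 2 (fun t => ‖g t‖) ^ 2 := by
    rw [normL_two_sq hG, normL_two_sq hn]
    simp_rw [hsq]
    rw [integral_add (hn2.integrable.const_mul _) (hintr.const_mul _), integral_const_mul,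
      integral_const_mul, h3, hint0]
    simp
  have hpw : ((2 * Real.pi) ^ (-((2 : ENNReal)⁻¹).toReal)) ^ 2 = (2 * Real.pi)⁻¹ := by
    rw [← Real.rpow_natCast, ← Real.rpow_mul (by positivity), ENNReal.toReal_inv,
      ENNReal.toReal_ofNat, show -(2 : ℝ)⁻¹ * ((2 : ℕ) : ℝ) = -1 by norm_num, Real.rpow_neg_one]
  refine (pow_left_inj₀ (normL_nonneg _ _) (mul_nonneg (mul_nonneg (by positivity)
    (normL_nonneg _ _)) (normL_nonneg _ _)) two_ne_zero).1 ?_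
  rw [hmain, mul_pow, mul_pow, hpw, hcos]
  have := Real.pi_ne_zero
  field_simp
  rfl

end

/-! ### Comparison of the heat coefficients with a geometric progression -/

section HeatPsi

variable {q : ℝ} (h0 : 0 < q) (h1 : q < 1)

include h0 in
lemma heatPsi_eq (k : ℕ) : heatPsi q k = 2 * q ^ k / (1 + q ^ (2 * k)) := by
  have : q ^ k ≠ 0 := by positivity
  have h2 : 1 + (q ^ k) ^ 2 ≠ 0 := by positivity
  rw [heatPsi, pow_mul' q 2 k]
  field_simp
  ring

include h0 in
lemma heatPsi_pos (k : ℕ) : 0 < heatPsi q k := by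
  unfold heatPsi; positivity

include h0 h1 in
lemma summable_heatPsi : Summable (heatPsi q) := by
  refine Summable.of_nonneg_of_le (fun k => (heatPsi_pos h0 k).le) (fun k => ?_)
    ((summable_geometric_of_lt_one h0.le h1).mul_left 2)
  rw [heatPsi_eq h0]
  exact div_le_self (by positivity) (by linarith [show 0 < q ^ (2 * k) by positivity])

include h0 h1 in
-- The difference is exactly `ψ(m) q^{2m} q^j (1 - q^{2j}) / (1 + q^{2(j+m)})`. Recording that it
-- vanishes at `j = 0` yields the extra factor `q` in the remainder.
lemma abs_heatPsi_sub_le (m j : ℕ) :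
    |heatPsi q (j + m) - heatPsi q m * q ^ j| ≤
      heatPsi q m * q ^ (2 * m) * (if j = 0 then 0 else q ^ j) := by
  rcases eq_or_ne j 0 with rfl | hj
  · simp
  rw [if_neg hj]
  have e : heatPsi q (j + m) - heatPsi q m * q ^ j =
      heatPsi q m * q ^ (2 * m) * q ^ j * ((1 - q ^ (2 * j)) / (1 + q ^ (2 * (j + m)))) := by
    rw [heatPsi_eq h0, heatPsi_eq h0]
    have h2 : 1 + q ^ (2 * m) ≠ 0 := by positivity
    have h3 : 1 + q ^ (2 * (j + m)) ≠ 0 := by positivity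
    field_simp
    ring
  have hpos := heatPsi_pos h0 m
  have hle : q ^ (2 * j) ≤ 1 := pow_le_one₀ h0.le h1.le
  have hf0 : 0 ≤ (1 - q ^ (2 * j)) / (1 + q ^ (2 * (j + m))) :=
    div_nonneg (by linarith) (by positivity)
  rw [e, abs_of_nonneg (by positivity)]
  refine mul_le_of_le_one_right (by positivity) ?_
  rw [div_le_one (by positivity)]
  have : 0 < q ^ (2 * j) := by positivity
  have : 0 < q ^ (2 * (j + m)) := by positivity
  linarith

include h0 h1 in
-- The weight is at most `p` and at most `j + 1`; the two resulting sums give the two entries of the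
-- minimum.
lemma hasSum_weight_geometric (p : ℕ) :
    ∃ S : ℝ, HasSum (fun j : ℕ => ((min p (j + 1) : ℕ) : ℝ) * (if j = 0 then 0 else q ^ j)) S ∧
      S ≤ 2 * q / (1 - q) * min (p : ℝ) (1 / (1 - q)) := by
  have hq1 : 0 < 1 - q := by linarith
  have hqn : ‖q‖ < 1 := by rwa [Real.norm_of_nonneg h0.le]
  have hg : HasSum (fun j : ℕ => if j = 0 then 0 else q ^ j) (q / (1 - q)) := by
    rw [← hasSum_nat_add_iff' 1]
    simpa [pow_succ', div_eq_mul_inv] using (hasSum_geometric_of_lt_one h0.le h1).mul_left q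
  have ha : HasSum (fun j : ℕ => ((j + 1 : ℕ) : ℝ) * (if j = 0 then 0 else q ^ j))
      (q / (1 - q) ^ 2 + q / (1 - q)) := by
    convert! (hasSum_coe_mul_geometric_of_norm_lt_one hqn).add hg using 2 with j
    split_ifs with hj
    · simp [hj]
    · push_cast; ring
  have hnn : ∀ j : ℕ, (0 : ℝ) ≤ if j = 0 then 0 else q ^ j := fun j => by split_ifs <;> positivity
  have hle1 : ∀ j : ℕ, ((min p (j + 1) : ℕ) : ℝ) * (if j = 0 then 0 else q ^ j) ≤
      p * (if j = 0 then 0 else q ^ j) := fun j =>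
    mul_le_mul_of_nonneg_right (by exact_mod_cast min_le_left _ _) (hnn j)
  have hle2 : ∀ j : ℕ, ((min p (j + 1) : ℕ) : ℝ) * (if j = 0 then 0 else q ^ j) ≤
      ((j + 1 : ℕ) : ℝ) * (if j = 0 then 0 else q ^ j) := fun j =>
    mul_le_mul_of_nonneg_right (by exact_mod_cast min_le_right _ _) (hnn j)
  have hs := Summable.of_nonneg_of_le (fun j => mul_nonneg (Nat.cast_nonneg _) (hnn j)) hle2
    ha.summable
  refine ⟨_, hs.hasSum, ?_⟩
  have b1 := hasSum_le hle1 hs.hasSum (hg.mul_left (p : ℝ))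
  have b2 := hasSum_le hle2 hs.hasSum ha
  rw [mul_min_of_nonneg _ _ (by positivity)]
  refine le_min ?_ ?_
  · refine b1.trans ?_
    have : 0 ≤ q / (1 - q) * p := by positivity
    calc (p : ℝ) * (q / (1 - q)) ≤ q / (1 - q) * p + q / (1 - q) * p := by linarith
      _ = _ := by ring
  · refine b2.trans ?_
    have : q / (1 - q) ≤ q / (1 - q) ^ 2 := by
      gcongr
      nlinarith
    calc _ ≤ q / (1 - q) ^ 2 + q / (1 - q) ^ 2 := by linarith
      _ = _ := by field_simp; ring

end HeatPsi

lemma abs_normL_sub_le {u : ENNReal} (hu : 1 ≤ u) {f g : ℝ → ℝ} (hf : MemC f) (hg : MemC g) {D : ℝ}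
    (hD : ∀ t, |f t - g t| ≤ D) : |normL u f - normL u g| ≤ 2 * Real.pi * D := by
  have hfL := memLp_of_continuous_periodic hf.1 hf.2 u
  have hgL := memLp_of_continuous_periodic hg.1 hg.2 u
  have hD0 : 0 ≤ D := (abs_nonneg _).trans (hD 0)
  have key : ∀ f g : ℝ → ℝ, MemLp f u periodMeasure → MemLp g u periodMeasure →
      (∀ t, |f t - g t| ≤ D) → normL u f ≤ normL u g + 2 * Real.pi * D := by
    intro f g hf hg h
    have h1 : eLpNorm f u periodMeasure ≤ eLpNorm g u periodMeasure +
        ENNReal.ofReal (2 * Real.pi * D) := by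
      calc _ = eLpNorm (g + (f - g)) u periodMeasure := by congr 1; abel
        _ ≤ _ := (eLpNorm_add_le hg.1 (hf.sub hg).1 hu).trans
          (add_le_add_right (eLpNorm_le_two_pi_mul hu h) _)
    have h2 := ENNReal.toReal_mono (ENNReal.add_ne_top.2 ⟨hg.2.ne, ENNReal.ofReal_ne_top⟩) h1
    rwa [ENNReal.toReal_add hg.2.ne ENNReal.ofReal_ne_top,
      ENNReal.toReal_ofReal (by positivity)] at h2
  have a1 := key f g hfL hgL hD
  have a2 := key g f hgL hfL fun t => by rw [abs_sub_comm]; exact hD t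
  rw [abs_le]
  constructor <;> linarith

/-! ### The norm of the deviation kernel -/

section Kernel

variable {q : ℝ} (h0 : 0 < q) (h1 : q < 1)

include h0 h1 in
lemma abs_vpKern_sub_modulated_le (β : ℝ) (n p : ℕ) (t : ℝ) :
    |vpKern (heatPsi q) β n p t - heatPsi q (n - p + 1) *
      modulated (fun t => vpGen p (circleMap 0 q t)) (n - p + 1) (β * Real.pi / 2) 0 t| ≤
    heatPsi q (n - p + 1) *
      (2 * (q ^ (2 * (n - p) + 3) / (1 - q) ^ 2 * min (p : ℝ) (1 / (1 - q)))) := by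
  set m := n - p + 1 with hm
  set B := β * Real.pi / 2
  have hK := hasSum_kern (summable_vpKern (summable_heatPsi h0 h1) (heatPsi_pos h0) n p) B t
  -- The weights vanish for `k < m`, so the series may start at `k = m`, where they become `min p
  -- (j+1)`.
  rw [← hasSum_nat_add_iff' m, Finset.sum_eq_zero (fun k hk => by
    rw [vpWeight_eq_zero (by have := Finset.mem_range.1 hk; omega)]; simp), sub_zero] at hK
  simp only [hm, vpWeight_add] at hK
  rw [← hm] at hK
  have hG := ((hasSum_vpGen p (norm_circleMap_lt h0 h1 t)).mul_left
    (Complex.exp (((m * t - B + 0 : ℝ) : ℂ) * Complex.I)))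
  have hG2 := (Complex.hasSum_re hG).mul_left (heatPsi q m)
  have e : ∀ j : ℕ, (Complex.exp (((m * t - B + 0 : ℝ) : ℂ) * Complex.I) *
      (((min p (j + 1) : ℕ) : ℂ) * circleMap 0 q t ^ j)).re =
      ((min p (j + 1) : ℕ) : ℝ) * q ^ j * Real.cos (((j + m : ℕ) : ℝ) * t - B) := by
    intro j
    have : Complex.exp (((m * t - B + 0 : ℝ) : ℂ) * Complex.I) *
      (((min p (j + 1) : ℕ) : ℂ) * circleMap 0 q t ^ j) =
      ((((min p (j + 1) : ℕ) : ℝ) * q ^ j : ℝ) : ℂ) *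
        Complex.exp (((((j + m : ℕ) : ℝ) * t - B : ℝ) : ℂ) * Complex.I) := by
      have e2 : Complex.exp (((((j + m : ℕ) : ℝ) * t - B : ℝ) : ℂ) * Complex.I) =
          Complex.exp (((m * t - B + 0 : ℝ) : ℂ) * Complex.I) *
            Complex.exp ((j : ℂ) * ((t : ℂ) * Complex.I)) := by
        rw [← Complex.exp_add]
        congr 1
        push_cast; ring
      rw [circleMap_zero_eq, mul_pow, ← Complex.exp_nat_mul, e2]
      generalize min p (j + 1) = w
      push_cast; ring
    rw [this, Complex.re_ofReal_mul, Complex.exp_ofReal_mul_I_re]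
  simp_rw [e] at hG2
  obtain ⟨S, hS, hSle⟩ := hasSum_weight_geometric h0 h1 p
  have hq1 : 0 < 1 - q := by linarith
  have hψ := heatPsi_pos h0 m
  have hb := hS.mul_left (heatPsi q m * q ^ (2 * m))
  have hdiff := hK.sub hG2
  change ‖kern _ B t - heatPsi q m * _‖ ≤ _
  rw [show modulated (fun t => vpGen p (circleMap 0 q t)) m B 0 t =
    (Complex.exp (((m * t - B + 0 : ℝ) : ℂ) * Complex.I) * vpGen p (circleMap 0 q t)).re from rfl,
    ← hdiff.tsum_eq]
  refine (tsum_of_norm_bounded hb fun j => ?_).trans ?_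
  · have e3 : ((min p (j + 1) : ℕ) : ℝ) * heatPsi q (j + m) * Real.cos (((j + m : ℕ) : ℝ) * t - B) -
        heatPsi q m * (((min p (j + 1) : ℕ) : ℝ) * q ^ j * Real.cos (((j + m : ℕ) : ℝ) * t - B)) =
        (((min p (j + 1) : ℕ) : ℝ) * (heatPsi q (j + m) - heatPsi q m * q ^ j)) *
          Real.cos (((j + m : ℕ) : ℝ) * t - B) := by ring
    rw [e3, Real.norm_eq_abs]
    refine (abs_mul_cos_le _ _).trans ?_
    rw [abs_mul, Nat.abs_cast, mul_left_comm]
    exact mul_le_mul_of_nonneg_left (abs_heatPsi_sub_le h0 h1 m j) (Nat.cast_nonneg _)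
  · have hmin : 0 ≤ min (p : ℝ) (1 / (1 - q)) := le_min (by positivity) (by positivity)
    rw [mul_assoc]
    refine mul_le_mul_of_nonneg_left ?_ hψ.le
    calc q ^ (2 * m) * S ≤ q ^ (2 * m) * (2 * q / (1 - q) * min (p : ℝ) (1 / (1 - q))) := by gcongr
      _ = 2 * (q ^ (2 * (n - p) + 3) / (1 - q) * min (p : ℝ) (1 / (1 - q))) := by
          rw [hm, show 2 * (n - p) + 3 = 2 * (n - p + 1) + 1 by ring, pow_succ]; ring
      -- The bound obtained has only the first power of `1 - q`; it is weakened to the second power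
      -- used in `remainder`.
      _ ≤ _ := by
          gcongr
          nlinarith

include h0 h1 in
lemma abs_normL_modulated_vpGen_sub_le {s u : ENNReal} (hsu : ENNReal.HolderConjugate s u)
    (n p : ℕ) (b : ℝ) :
    |normL u (modulated (fun t => vpGen p (circleMap 0 q t)) (n - p + 1) b 0) -
      Real.pi * mainConst q p u| ≤
    8 * Real.pi ^ 2 *
      (q * deltaConst s / (((n - p + 1 : ℕ) : ℝ) * (1 - q) ^ sigmaExp u p)) := by
  have hu : 1 ≤ u := hsu.symm.one_le
  have hq1 : 0 < 1 - q := by linarith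
  have hM : Real.pi * mainConst q p u = (2 * Real.pi) ^ (-(u⁻¹).toReal) * normL u Real.cos *
      normL u (fun t => ‖vpGen p (circleMap 0 q t)‖) := by
    simp_rw [norm_vpGen_circleMap]
    rw [mainConst, kConst, Real.mul_rpow (by norm_num) Real.pi_pos.le, Real.rpow_add Real.pi_pos,
      Real.rpow_one, Real.rpow_neg Real.pi_pos.le]
    have := Real.pi_pos
    have : Real.pi ^ (u⁻¹).toReal ≠ 0 := by positivity
    field_simp
  rw [hM]
  by_cases hs : s = 2
  · subst hs
    have hu2 : u = 2 := by
      refine (ENNReal.HolderConjugate.unique 2 2 u).symm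
    subst hu2
    rw [normL_two_modulated h0 h1 p (by omega) b]
    simp [deltaConst]
  · rw [deltaConst, if_neg hs, mul_one]
    exact abs_normL_modulated_sub_le (periodic_vpGen_circleMap q p)
      (continuous_vpGen_circleMap h0 h1 p) _ b hu (by omega) (by positivity)
      fun θ hθ => eLpNorm_vpGen_sub_le h0 h1 hu (by omega) hθ

lemma deltaConst_nonneg (s : ENNReal) : 0 ≤ deltaConst s := by
  unfold deltaConst; split_ifs <;> norm_num

include h0 h1 in
lemma remainder_pos (n : ℕ) {p : ℕ} (hp : 1 ≤ p) (s u : ENNReal) : 0 < remainder q n p s u := by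
  have hq1 : 0 < 1 - q := by linarith
  have hδ := deltaConst_nonneg s
  have hmin : 0 < min (p : ℝ) (1 / (1 - q)) := lt_min (by positivity) (by positivity)
  unfold remainder
  positivity

include h0 h1 in
/-- The norm of the kernel, up to the remainder. -/
lemma abs_normL_vpKern_sub_le {s u : ENNReal} (hsu : ENNReal.HolderConjugate s u) (β : ℝ)
    (n p : ℕ) :
    |normL u (vpKern (heatPsi q) β n p) -
      heatPsi q (n - p + 1) * (Real.pi * mainConst q p u)| ≤
    heatPsi q (n - p + 1) * (Real.pi * (32 * remainder q n p s u)) := by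
  have hu : 1 ≤ u := hsu.symm.one_le
  have hq1 : 0 < 1 - q := by linarith
  have hδ := deltaConst_nonneg s
  have hψ := heatPsi_pos h0 (n - p + 1)
  have hG : MemC (modulated (fun t => vpGen p (circleMap 0 q t)) (n - p + 1)
      (β * Real.pi / 2) 0) :=
    ⟨periodic_modulated (periodic_vpGen_circleMap q p) _ _ _,
      continuous_modulated (continuous_vpGen_circleMap h0 h1 p) _ _ _⟩
  have hψG : MemC fun t => heatPsi q (n - p + 1) * modulated (fun t => vpGen p (circleMap 0 q t))
      (n - p + 1) (β * Real.pi / 2) 0 t :=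
    ⟨fun t => by simp only [hG.1 t], continuous_const.mul hG.2⟩
  have a1 := abs_normL_sub_le hu
    (memC_kern (summable_vpKern (summable_heatPsi h0 h1) (heatPsi_pos h0) n p) (β * Real.pi / 2))
    hψG (abs_vpKern_sub_modulated_le h0 h1 β n p)
  rw [normL_const_mul, abs_of_pos hψ] at a1
  have a2 := mul_le_mul_of_nonneg_left
    (abs_normL_modulated_vpGen_sub_le h0 h1 hsu n p (β * Real.pi / 2)) hψ.le
  rw [← abs_of_pos hψ, ← abs_mul, abs_of_pos hψ, mul_sub] at a2
  refine (abs_sub_le _ _ _).trans ((add_le_add a1 a2).trans ?_)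
  set r1 := q * deltaConst s / (((n - p + 1 : ℕ) : ℝ) * (1 - q) ^ sigmaExp u p) with hr1
  set r2 := q ^ (2 * (n - p) + 3) / (1 - q) ^ 2 * min (p : ℝ) (1 / (1 - q)) with hr2
  have hr1' : 0 ≤ r1 := by positivity
  have hr2' : 0 ≤ r2 := mul_nonneg (by positivity) (le_min (by positivity) (by positivity))
  have hrem : remainder q n p s u = r1 + r2 := rfl
  rw [hrem]
  have hpi := Real.pi_pos
  have hpi4 := Real.pi_le_four
  -- With `π` taken out, the constants are `8π ≤ 32` for the oscillation error and `4` for the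
  -- coefficient error.
  calc _ = heatPsi q (n - p + 1) * (Real.pi * (8 * Real.pi * r1 + 4 * r2)) := by ring
    _ ≤ heatPsi q (n - p + 1) * (Real.pi * (32 * (r1 + r2))) := by
        gcongr
        nlinarith [mul_le_mul_of_nonneg_right hpi4 hr1']

end Kernel

/-! ### Bounds for the deviation and a nearly extremal function -/

section Deviation

variable {q : ℝ} (h0 : 0 < q) (h1 : q < 1) {β : ℝ} {s u : ENNReal}
  (hsu : ENNReal.HolderConjugate s u) {n p : ℕ} (hp : 1 ≤ p) (hpn : p ≤ n) {f φ : ℝ → ℝ}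
  (hf : MemCPsiBeta (heatPsi q) β s f φ)

include h0 h1 hsu hp hpn hf in
lemma abs_rho_le (x : ℝ) :
    |rho n p f x| ≤ (1 / (p * Real.pi)) *
      (bestApprox (n - p + 1) s φ * normL u (vpKern (heatPsi q) β n p)) := by
  rw [rho_eq_integral (summable_heatPsi h0 h1) (heatPsi_pos h0) hf.1 hf.2.2 hp hpn, abs_mul,
    abs_of_pos (by positivity)]
  gcongr
  exact abs_integral_mul_vpKern_le (summable_heatPsi h0 h1) (heatPsi_pos h0) β n p hsu hf.2.1.2 x

include h0 h1 hsu hp hpn hf in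
lemma normC_rho_le :
    normC (rho n p f) ≤ (1 / (p * Real.pi)) *
      (bestApprox (n - p + 1) s φ * normL u (vpKern (heatPsi q) β n p)) :=
  ciSup_le fun x => abs_rho_le h0 h1 hsu hp hpn hf x

include h0 h1 hsu hp hpn hf in
lemma abs_rho_le_normC (x : ℝ) : |rho n p f x| ≤ normC (rho n p f) :=
  le_ciSup (f := fun x => |rho n p f x|)
    ⟨_, by rintro _ ⟨y, rfl⟩; exact abs_rho_le h0 h1 hsu hp hpn hf y⟩ x

include h0 h1 hsu hp hpn hf in
/-- The upper bound is almost attained by a function with the same best approximation. -/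
lemma exists_near_extremal {η : ℝ} (hη : 0 < η) :
    ∃ F Φ : ℝ → ℝ, MemCPsiBeta (heatPsi q) β s F Φ ∧
      bestApprox (n - p + 1) s Φ = bestApprox (n - p + 1) s φ ∧
      (1 / (p * Real.pi)) * (bestApprox (n - p + 1) s φ *
        (normL u (vpKern (heatPsi q) β n p) - η)) ≤ normC (rho n p F) := by
  have hψ := summable_heatPsi h0 h1
  have hψ0 := heatPsi_pos h0
  set K := vpKern (heatPsi q) β n p with hK
  set E := bestApprox (n - p + 1) s φ with hE
  have hE0 : 0 ≤ E := bestApprox_nonneg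
  have hnc : 0 ≤ normC (rho n p f) :=
    (abs_nonneg _).trans (abs_rho_le_normC h0 h1 hsu hp hpn hf 0)
  -- If the required lower bound is not positive, `f` itself serves; otherwise `E > 0`, which
  -- permits rescaling.
  rcases le_or_gt (E * (normL u K - η)) 0 with hneg | hposE
  · exact ⟨f, φ, hf, rfl, (mul_nonpos_of_nonneg_of_nonpos (by positivity) hneg).trans hnc⟩
  have hE1 : 0 < E := hE0.lt_of_ne fun h => by rw [← h, zero_mul] at hposE; exact lt_irrefl _ hposE
  have hN : 0 < normL u K - η := (pos_iff_pos_of_mul_pos hposE).1 hE1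
  have hKC : MemC K := memC_kern (summable_vpKern hψ hψ0 n p) _
  have hKr : MemC fun t => K (0 - t) := by
    refine ⟨fun t => ?_, hKC.2.comp (by fun_prop)⟩
    simp only
    rw [← hKC.1 (0 - (t + 2 * Real.pi))]
    congr 1; ring
  have hKn : normL u (fun t => K (0 - t)) = normL u K := by
    rw [normL, eLpNorm_comp_sub_left hKC.1 hKC.2, normL]
  obtain ⟨Φ₀, hper, hmem, hnorm, hlow⟩ := exists_near_norming hsu hKr
    (c := normL u K - η) (by rw [hKn]; linarith)
  set e := bestApprox (n - p + 1) s Φ₀ with he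
  have he1 : e ≤ 1 := bestApprox_le_normL.trans hnorm
  -- A vanishing best approximation of `Φ₀` would make its integral against `K` nonpositive, by the
  -- upper bound.
  have he0 : 0 < e := by
    have hup := (le_abs_self _).trans (abs_integral_mul_vpKern_le hψ hψ0 β n p hsu hmem 0)
    have : 0 < e * normL u K := hN.trans_le (hlow.trans hup)
    exact (bestApprox_nonneg).lt_of_ne fun h => by
      rw [he, ← h, zero_mul] at this; exact lt_irrefl _ this
  set c := fourierA Φ₀ 0 / 2 with hc
  have hi : Integrable Φ₀ periodMeasure := hmem.integrable hsu.one_le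
  have hcpoly : (fun _ => c) ∈ trigPoly (n - p + 1) := trigPoly_const (by omega) c
  -- A derivative must have mean zero. Removing the constant changes neither the best approximation
  -- nor the integral against `K`; the factor `E / e` restores the prescribed best approximation.
  set Φ : ℝ → ℝ := fun t => E / e * (Φ₀ t - c) with hΦ
  have hΦs : MemLp Φ s periodMeasure := (hmem.sub (memLp_const c)).const_mul _
  have hΦper : Function.Periodic Φ (2 * Real.pi) := fun t => by simp only [hΦ, hper t]
  have hΦ1 : MemL 1 Φ := ⟨hΦper, hΦs.mono_exponent hsu.one_le⟩
  have hΦ0 : fourierA Φ 0 = 0 := by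
    have hA : ∫ t, Φ₀ t ∂periodMeasure = Real.pi * (2 * c) := by
      have : fourierA Φ₀ 0 = (1 / Real.pi) * ∫ t, Φ₀ t ∂periodMeasure := by
        rw [fourierA_eq]; simp
      rw [hc, this]
      have := Real.pi_ne_zero
      field_simp
    rw [fourierA_eq]
    simp only [hΦ, Nat.cast_zero, zero_mul, Real.cos_zero, mul_one]
    rw [integral_const_mul, integral_sub hi (integrable_const c), hA, integral_const,
      measureReal_def, periodMeasure_univ, ENNReal.toReal_ofReal Real.two_pi_pos.le, smul_eq_mul]
    ring
  have hF : MemCPsiBeta (heatPsi q) β s (psiInt (heatPsi q) β 0 Φ) Φ :=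
    ⟨memC_trigSeries (summable_psiInt hψ hψ0 (memLp_one_iff_integrable.1 hΦ1.2) β 0),
      ⟨hΦper, hΦs⟩, isPsiBetaDeriv_psiInt hψ hψ0 hΦ1 hΦ0 β 0⟩
  refine ⟨_, Φ, hF, ?_, ?_⟩
  · rw [hΦ, bestApprox_const_mul (div_pos hE1 he0), bestApprox_sub_trigPoly hcpoly, ← he,
      div_mul_cancel₀ _ he0.ne']
  · refine le_trans ?_ (abs_rho_le_normC h0 h1 hsu hp hpn hF 0)
    refine le_trans ?_ (le_abs_self _)
    rw [rho_eq_integral hψ hψ0 hF.1 hF.2.2 hp hpn]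
    refine mul_le_mul_of_nonneg_left ?_ (by positivity)
    have hval : ∫ t, Φ t * K (0 - t) ∂periodMeasure =
        E / e * ∫ t, Φ₀ t * K (0 - t) ∂periodMeasure := by
      obtain ⟨C, hC⟩ := exists_forall_norm_le hKr.1 hKr.2
      have hi1 := integrable_mul_of_bound hi hKr.2 hC
      have hi2 : Integrable (fun t => c * K (0 - t)) periodMeasure := hKr.integrable.const_mul c
      simp_rw [hΦ, mul_assoc, sub_mul]
      rw [integral_const_mul, integral_sub hi1 hi2,
        integral_trigPoly_mul_vpKern hψ hψ0 β n p hcpoly 0, sub_zero]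
    rw [← hK, hval]
    -- Since `e ≤ ‖Φ₀‖ ≤ 1`, the rescaling can only enlarge the deviation.
    have hEe : E ≤ E / e := le_div_self hE0 he0 he1
    have := hN.le
    calc E * (normL u K - η) ≤ E / e * (normL u K - η) := by gcongr
      _ ≤ _ := by gcongr

end Deviation

end VallePoussin

/-! ### The theorem -/

theorem mainTheorem6 :
    ∃ A : ℝ, 0 < A ∧
      ∀ (q β : ℝ), 0 < q → q < 1 →
      ∀ (s s' : ENNReal), 1 ≤ s → s' = ENNReal.conjExponent s →
      ∀ (n p : ℕ), 1 ≤ p → p ≤ n →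
      ∀ (f φ : ℝ → ℝ),
        VallePoussin.MemCPsiBeta (VallePoussin.heatPsi q) β s f φ →
        (VallePoussin.normC (VallePoussin.rho n p f) ≤
          VallePoussin.leadFactor q n p *
            (VallePoussin.mainConst q p s' + A * VallePoussin.remainder q n p s s') *
            VallePoussin.bestApprox (n - p + 1) s φ) ∧
        ∃ (F Φ : ℝ → ℝ),
          VallePoussin.MemCPsiBeta (VallePoussin.heatPsi q) β s F Φ ∧
          VallePoussin.bestApprox (n - p + 1) s Φ = VallePoussin.bestApprox (n - p + 1) s φ ∧
          ∃ θ : ℝ, |θ| ≤ A ∧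
            VallePoussin.normC (VallePoussin.rho n p F) =
              VallePoussin.leadFactor q n p *
                (VallePoussin.mainConst q p s' + θ * VallePoussin.remainder q n p s s') *
                VallePoussin.bestApprox (n - p + 1) s Φ := by
  -- `32` comes from the kernel norm and `1` from the slack `η = ψ π R` in the nearly extremal
  -- function.
  refine ⟨33, by norm_num, ?_⟩
  intro q β h0 h1 s u hs hu n p hp hpn f φ hf
  have hsu : ENNReal.HolderConjugate s u := hu ▸ ENNReal.HolderConjugate.conjExponent hs
  have hψ := VallePoussin.heatPsi_pos h0 (n - p + 1)
  have hR := VallePoussin.remainder_pos h0 h1 n hp s u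
  have hker := VallePoussin.abs_normL_vpKern_sub_le h0 h1 hsu β n p
  have hlead : VallePoussin.leadFactor q n p = VallePoussin.heatPsi q (n - p + 1) / p := by
    rw [VallePoussin.heatPsi_eq h0, VallePoussin.leadFactor, div_div]
  have hp0 : (0 : ℝ) < p := by exact_mod_cast hp
  have hpi := Real.pi_pos
  set M := VallePoussin.mainConst q p u
  set R := VallePoussin.remainder q n p s u
  set ψ := VallePoussin.heatPsi q (n - p + 1)
  set N := VallePoussin.normL u (VallePoussin.vpKern (VallePoussin.heatPsi q) β n p)
  set E := VallePoussin.bestApprox (n - p + 1) s φ with hE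
  have hE0 : 0 ≤ E := VallePoussin.bestApprox_nonneg
  rw [abs_le] at hker
  have hupper : ∀ E : ℝ, 0 ≤ E → 1 / (p * Real.pi) * (E * N) ≤ ψ / p * (M + 32 * R) * E := by
    intro E hE
    calc 1 / (p * Real.pi) * (E * N) ≤ 1 / (p * Real.pi) * (E * (ψ * (Real.pi * (M + 32 * R)))) := by
          gcongr
          linarith [hker.2]
      _ = _ := by field_simp
  rw [hlead]
  have hmono : ∀ a b : ℝ, a ≤ b → ψ / p * (M + a * R) * E ≤ ψ / p * (M + b * R) * E := by
    intro a b hab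
    gcongr
  refine ⟨((VallePoussin.normC_rho_le h0 h1 hsu hp hpn hf).trans (hupper E hE0)).trans
    (hmono _ _ (by norm_num)), ?_⟩
  obtain ⟨F, Φ, hF, hΦE, hlow⟩ := VallePoussin.exists_near_extremal h0 h1 hsu hp hpn hf
    (η := ψ * (Real.pi * R)) (by positivity)
  refine ⟨F, Φ, hF, hΦE, ?_⟩
  have hup := (VallePoussin.normC_rho_le h0 h1 hsu hp hpn hF)
  rw [hΦE, ← hE] at hup ⊢
  have hup2 := hup.trans (hupper E hE0)
  have hlow2 : ψ / p * (M + (-33) * R) * E ≤ VallePoussin.normC (VallePoussin.rho n p F) := by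
    refine le_trans ?_ hlow
    calc ψ / p * (M + (-33) * R) * E = 1 / (p * Real.pi) * (E * (ψ * (Real.pi * (M - 33 * R)))) := by
          field_simp; ring
      _ ≤ _ := by
          gcongr
          linarith [hker.1]
  -- When `E = 0` both sides vanish and any `θ` works; otherwise the equation is solved for `θ`, and
  -- the two-sided bound gives `|θ| ≤ 33`.
  rcases hE0.eq_or_lt with hE1 | hE1
  · refine ⟨0, by norm_num, ?_⟩
    rw [← hE1, mul_zero] at hup2 hlow2 ⊢
    exact le_antisymm hup2 hlow2
  · have hc : 0 < ψ / p * E * R := by positivity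
    refine ⟨(VallePoussin.normC (VallePoussin.rho n p F) - ψ / p * M * E) / (ψ / p * E * R), ?_, ?_⟩
    · rw [abs_le, le_div_iff₀ hc, div_le_iff₀ hc]
      have := hc.le
      constructor <;> nlinarith
    · field_simp
      ring
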